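/- Let $(\Omega,\mathcal F,\mathbb P)$ be a probability space with sub-$\sigma$-algebras $\mathcal F_{-1}\subset\mathcal F_0\subset\mathcal F_1\subset\cdots$ of $\mathcal F$, and let $(w_k)_{k\ge0}$ be real square-integrable random variables with $w_k$ being $\mathcal F_k$-measurable, $\mathbb E[w_k\mid\mathcal F_{k-1}]=0$ and $\mathbb E[w_k^2\mid\mathcal F_{k-1}]=1$ for all $k\ge0$ (for instance $\mathcal F_{-1}$ trivial and $\mathcal F_k=\sigma(w_0,\dots,w_k)$). For $\rho\in\mathbb R$ let $L^{2,\rho}$ be the set of $\mathbb R^n$-valued processes $g=(g_k)_{k\ge0}$ with $g_k$ being $\mathcal F_{k-1}$-measurable and $\|g\|_\rho^2:=\mathbb E\sum_{k\ge0}e^{-\rho k}|g_k|^2<\infty$, and let $N^{2,\rho}=L^{2,\rho}\times L^{2,\rho}$. Given a deterministic map $\Lambda:\mathbb R^n\to\mathbb R^n$ and random maps $\Gamma=(f,b,\sigma)$, where $f(k+1,\cdot)$, $b(k,\cdot)$, $\sigma(k,\cdot)$ map $\Omega\times\mathbb R^{3n}$ to $\mathbb R^n$, consider the fully coupled forward-backward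 stochastic difference equation, denoted $(\Lambda,\Gamma)$: for all $k\ge0$, almost surely, $$x_{k+1}=b(k,\theta_k)+\sigma(k,\theta_k)w_k,\qquad y_k=-f(k+1,\theta_k),\qquad x_0=\Lambda(y_0),$$ where $\theta_k=(x_k,y'_{k+1},z'_{k+1})$, $y'_{k+1}=\mathbb E[y_{k+1}\mid\mathcal F_{k-1}]$ and $z'_{k+1}=\mathbb E[y_{k+1}w_k\mid\mathcal F_{k-1}]$. (A1) For each $\theta\in\mathbb R^{3n}$ and $k\ge0$, $f(k+1,\theta),b(k,\theta),\sigma(k,\theta)$ are $\mathcal F_{k-1}$-measurable; the processes $f(\cdot+1,0),b(\cdot,0),\sigma(\cdot,0)$ belong to $L^{2,\rho}$; and there are constants $L,L_1,\dots,L_7>0$ such that, for all $k$, almost surely, for all arguments, with $\widehat x=x-\bar x$, $\widehat y=y-\bar y$, $\widehat y'=y'-\bar y'$, $\widehat z'=z'-\bar z'$, $\theta=(x,y',z')$, $\bar\theta=(\bar x,\bar y',\bar z')$, $$|\Lambda(y)-\Lambda(\bar y)|\le L|\widehat y|,\quad |b(k,\theta)-b(k,\bar\theta)|\le L_1|\widehat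 x|+L_3|\widehat y'|+L_4|\widehat z'|,$$ $$|\sigma(k,\theta)-\sigma(k,\bar\theta)|\le L_1|\widehat x|+L_5|\widehat y'|+L_6|\widehat z'|,\quad |f(k+1,\theta)-f(k+1,\bar\theta)|\le L_7|\widehat x|+L_2(|\widehat y'|+|\widehat z'|).$$ (A2) There are $\mu,\nu\ge0$ with either $\mu>0=\nu$ or $\nu>0=\mu$, a matrix $M\in\mathbb R^{m\times n}$ and $\mathbb R^{m\times n}$-valued processes $A,B,C$, with $A_k,B_k,C_k$ being $\mathcal F_{k-1}$-measurable and bounded almost surely, uniformly in $k$, such that, for all $k$, almost surely, for all arguments, if $\mu>0$: $$|\Lambda(y)-\Lambda(\bar y)|\le\tfrac1\mu|M\widehat y|,\qquad |h(k,x,y',z')-h(k,x,\bar y',\bar z')|\le\tfrac1\mu|B_k\widehat y'+C_k\widehat z'|\quad(h=b,\sigma);$$ if $\nu>0$: $$|f(k+1,x,y',z')-f(k+1,\bar x,y',z')|\le\tfrac1\nu|A_k\widehat x|;$$ and in both cases $\langle\Lambda(y)-\Lambda(\bar y),\widehat y\rangle\le-\mu|M\widehat y|^2$ and $$\langle f(k+1,\theta)-f(k+1,\bar\theta),\widehat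 x\rangle+e^{-\rho}\langle b(k,\theta)-b(k,\bar\theta),\widehat y'\rangle+e^{-\rho}\langle\sigma(k,\theta)-\sigma(k,\bar\theta),\widehat z'\rangle\le-\nu|A_k\widehat x|^2-\mu|B_k\widehat y'+C_k\widehat z'|^2.$$ **Theorem.** Let $(\Lambda,\Gamma)$ satisfy (A1) and (A2), and let $\ln(4L_1^2)<\rho<-\ln(6L_2^2)$. Then the equation $(\Lambda,\Gamma)$ has a solution $(x,y)\in N^{2,\rho}$, unique up to almost sure equality. Moreover, there is a constant $K>0$ depending only on $L,L_1,\dots,L_7$, $\mu$, $\nu$ and on bounds of $M,A,B,C$ such that: 1. $\|x\|_\rho^2+\|y\|_\rho^2\le K\,\mathbb E[I]$, where $$I=\sum_{k\ge0}e^{-\rho k}|b(k,0)|^2+\sum_{k\ge0}e^{-\rho k}|\sigma(k,0)|^2+\sum_{k\ge0}e^{-\rho(k+1)}|f(k+1,0)|^2+|\Lambda(0)|^2;$$ 2. if $(\bar\Lambda,\bar\Gamma)$ is another set of coefficients satisfying (A1) and (A2) with the same $\rho$ (possibly with other constants, matrices and processes), and $(\bar x,\bar y)\in N^{2,\rho}$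 is a solution of the equation $(\bar\Lambda,\bar\Gamma)$, then $\|x-\bar x\|_\rho^2+\|y-\bar y\|_\rho^2\le K\,\mathbb E[\widehat I]$ with the same $K$, where $$\widehat I=\sum_{k\ge0}e^{-\rho k}|b(k,\bar\theta_k)-\bar b(k,\bar\theta_k)|^2+\sum_{k\ge0}e^{-\rho k}|\sigma(k,\bar\theta_k)-\bar\sigma(k,\bar\theta_k)|^2+\sum_{k\ge0}e^{-\rho(k+1)}|f(k+1,\bar\theta_k)-\bar f(k+1,\bar\theta_k)|^2+|\Lambda(\bar y_0)-\bar\Lambda(\bar y_0)|^2$$ and $\bar\theta_k=(\bar x_k,\mathbb E[\bar y_{k+1}\mid\mathcal F_{k-1}],\mathbb E[\bar y_{k+1}w_k\mid\mathcal F_{k-1}])$. -/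

import Mathlib

open MeasureTheory
open scoped ENNReal

/-- The Euclidean space `ℝⁿ`. -/
abbrev Vec (n : ℕ) : Type := EuclideanSpace ℝ (Fin n)

/-- The Frobenius norm `|A| = √(tr (A Aᵀ))` of a real matrix. -/
noncomputable def frobNorm {m n : ℕ} (A : Matrix (Fin m) (Fin n) ℝ) : ℝ :=
  Real.sqrt (A * A.transpose).trace

/-- The matrix-vector product `A x`, as a vector of the Euclidean space `ℝᵐ`. -/
noncomputable def matVec {m n : ℕ} (A : Matrix (Fin m) (Fin n) ℝ) (x : Vec n) : Vec m :=
  Matrix.toEuclideanLin A x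

section Spaces

variable {Ω : Type*} {mΩ : MeasurableSpace Ω}

/-- `w₀, w₁, …` is a real martingale difference sequence with unit conditional variance.
Throughout, `ℱ k` stands for the sigma-algebra `𝓕_{k-1}` of the information available before `w k`
is revealed (so `ℱ 0` is `𝓕_{-1}`); thus `w k` is `𝓕_k`-measurable, `E[w k | 𝓕_{k-1}] = 0` and
`E[(w k)² | 𝓕_{k-1}] = 1`. -/
structure IsNoise (P : Measure Ω) (ℱ : Filtration ℕ mΩ) (w : ℕ → Ω → ℝ) : Prop where
  adapted : ∀ k, StronglyMeasurable[ℱ (k + 1)] (w k)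
  memLp : ∀ k, MemLp (w k) 2 P
  mean_zero : ∀ k, P[w k | ℱ k] =ᵐ[P] fun _ => 0
  unit_variance : ∀ k, P[fun ω => w k ω ^ 2 | ℱ k] =ᵐ[P] fun _ => 1

/-- The square of the weighted norm, `E[∑ₖ e^{-ρ k} |g k|²]`, as an extended nonnegative real. -/
noncomputable def sqNorm (P : Measure Ω) (ρ : ℝ) {n : ℕ} (g : ℕ → Ω → Vec n) : ℝ≥0∞ :=
  ∫⁻ ω, ∑' k : ℕ, ENNReal.ofReal (Real.exp (-ρ * k)) * ‖g k ω‖ₑ ^ 2 ∂P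

/-- The weighted space `L^{2,ρ}`: processes `g` with `g k` measurable with respect to
`𝓕_{k-1}` and with finite weighted norm. -/
def MemL2 (P : Measure Ω) (ℱ : Filtration ℕ mΩ) (ρ : ℝ) {n : ℕ} (g : ℕ → Ω → Vec n) : Prop :=
  (∀ k, StronglyMeasurable[ℱ k] (g k)) ∧ sqNorm P ρ g < ∞

/-- The matrix-valued process `A` belongs to `L^∞` with bound `c`: `A k` is
`𝓕_{k-1}`-measurable and `|A k| ≤ c` almost surely, for all `k`. -/
def MemLinf (P : Measure Ω) (ℱ : Filtration ℕ mΩ) (c : ℝ) {m n : ℕ}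
    (A : ℕ → Ω → Matrix (Fin m) (Fin n) ℝ) : Prop :=
  ∀ k, (∀ i j, StronglyMeasurable[ℱ k] fun ω => A k ω i j) ∧ ∀ᵐ ω ∂P, frobNorm (A k ω) ≤ c

end Spaces

/-- The coefficients `(Λ, Γ)` with `Γ = (f, b, σ)`. The maps `b k`, `σ k`, `f k` take the sample
point and then the three components of `θ = (x, y', z')`. -/
structure Coefficients (Ω : Type*) (n : ℕ) where
  Λ : Vec n → Vec n
  b : ℕ → Ω → Vec n → Vec n → Vec n → Vec n
  σ : ℕ → Ω → Vec n → Vec n → Vec n → Vec n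
  f : ℕ → Ω → Vec n → Vec n → Vec n → Vec n

/-- The eight positive Lipschitz constants. -/
structure LipschitzConstants where
  L : ℝ
  L₁ : ℝ
  L₂ : ℝ
  L₃ : ℝ
  L₄ : ℝ
  L₅ : ℝ
  L₆ : ℝ
  L₇ : ℝ
  L_pos : 0 < L
  L₁_pos : 0 < L₁
  L₂_pos : 0 < L₂
  L₃_pos : 0 < L₃
  L₄_pos : 0 < L₄
  L₅_pos : 0 < L₅
  L₆_pos : 0 < L₆
  L₇_pos : 0 < L₇

section Equation

variable {Ω : Type*} {mΩ : MeasurableSpace Ω} {n : ℕ}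

/-- Measurability, integrability at the origin, and Lipschitz continuity of the coefficients. -/
structure LipschitzAssumption (P : Measure Ω) (ℱ : Filtration ℕ mΩ) (ρ : ℝ)
    (ℓ : LipschitzConstants) (Φ : Coefficients Ω n) : Prop where
  meas_b : ∀ k x y' z', StronglyMeasurable[ℱ k] fun ω => Φ.b k ω x y' z'
  meas_σ : ∀ k x y' z', StronglyMeasurable[ℱ k] fun ω => Φ.σ k ω x y' z'
  meas_f : ∀ k x y' z', StronglyMeasurable[ℱ k] fun ω => Φ.f (k + 1) ω x y' z'
  memL2_b : MemL2 P ℱ ρ fun k ω => Φ.b k ω 0 0 0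
  memL2_σ : MemL2 P ℱ ρ fun k ω => Φ.σ k ω 0 0 0
  memL2_f : MemL2 P ℱ ρ fun k ω => Φ.f (k + 1) ω 0 0 0
  lip_Λ : ∀ y₁ y₂, ‖Φ.Λ y₁ - Φ.Λ y₂‖ ≤ ℓ.L * ‖y₁ - y₂‖
  lip_b : ∀ k, ∀ᵐ ω ∂P, ∀ x₁ x₂ y₁ y₂ z₁ z₂,
    ‖Φ.b k ω x₁ y₁ z₁ - Φ.b k ω x₂ y₂ z₂‖ ≤
      ℓ.L₁ * ‖x₁ - x₂‖ + ℓ.L₃ * ‖y₁ - y₂‖ + ℓ.L₄ * ‖z₁ - z₂‖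
  lip_σ : ∀ k, ∀ᵐ ω ∂P, ∀ x₁ x₂ y₁ y₂ z₁ z₂,
    ‖Φ.σ k ω x₁ y₁ z₁ - Φ.σ k ω x₂ y₂ z₂‖ ≤
      ℓ.L₁ * ‖x₁ - x₂‖ + ℓ.L₅ * ‖y₁ - y₂‖ + ℓ.L₆ * ‖z₁ - z₂‖
  lip_f : ∀ k, ∀ᵐ ω ∂P, ∀ x₁ x₂ y₁ y₂ z₁ z₂,
    ‖Φ.f (k + 1) ω x₁ y₁ z₁ - Φ.f (k + 1) ω x₂ y₂ z₂‖ ≤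
      ℓ.L₇ * ‖x₁ - x₂‖ + ℓ.L₂ * (‖y₁ - y₂‖ + ‖z₁ - z₂‖)

/-- The domination and monotonicity conditions. A domination condition with factor `1 / μ`
(or `1 / ν`) is void when `μ = 0` (or `ν = 0`). -/
structure DominationMonotonicity (P : Measure Ω) (ρ μ ν : ℝ) {m : ℕ}
    (M : Matrix (Fin m) (Fin n) ℝ) (A B C : ℕ → Ω → Matrix (Fin m) (Fin n) ℝ)
    (Φ : Coefficients Ω n) : Prop where
  cases_μν : (0 < μ ∧ ν = 0) ∨ (μ = 0 ∧ 0 < ν)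
  dom_Λ : μ ≠ 0 → ∀ y₁ y₂, ‖Φ.Λ y₁ - Φ.Λ y₂‖ ≤ 1 / μ * ‖matVec M (y₁ - y₂)‖
  dom_f : ν ≠ 0 → ∀ k, ∀ᵐ ω ∂P, ∀ x₁ x₂ y' z',
    ‖Φ.f (k + 1) ω x₁ y' z' - Φ.f (k + 1) ω x₂ y' z'‖ ≤ 1 / ν * ‖matVec (A k ω) (x₁ - x₂)‖
  dom_b : μ ≠ 0 → ∀ k, ∀ᵐ ω ∂P, ∀ x y₁ y₂ z₁ z₂,
    ‖Φ.b k ω x y₁ z₁ - Φ.b k ω x y₂ z₂‖ ≤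
      1 / μ * ‖matVec (B k ω) (y₁ - y₂) + matVec (C k ω) (z₁ - z₂)‖
  dom_σ : μ ≠ 0 → ∀ k, ∀ᵐ ω ∂P, ∀ x y₁ y₂ z₁ z₂,
    ‖Φ.σ k ω x y₁ z₁ - Φ.σ k ω x y₂ z₂‖ ≤
      1 / μ * ‖matVec (B k ω) (y₁ - y₂) + matVec (C k ω) (z₁ - z₂)‖
  mono_Λ : ∀ y₁ y₂, inner ℝ (Φ.Λ y₁ - Φ.Λ y₂) (y₁ - y₂) ≤ -μ * ‖matVec M (y₁ - y₂)‖ ^ 2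
  mono_Γ : ∀ k, ∀ᵐ ω ∂P, ∀ x₁ x₂ y₁ y₂ z₁ z₂,
    inner ℝ (Φ.f (k + 1) ω x₁ y₁ z₁ - Φ.f (k + 1) ω x₂ y₂ z₂) (x₁ - x₂)
      + Real.exp (-ρ) * inner ℝ (Φ.b k ω x₁ y₁ z₁ - Φ.b k ω x₂ y₂ z₂) (y₁ - y₂)
      + Real.exp (-ρ) * inner ℝ (Φ.σ k ω x₁ y₁ z₁ - Φ.σ k ω x₂ y₂ z₂) (z₁ - z₂)
    ≤ -ν * ‖matVec (A k ω) (x₁ - x₂)‖ ^ 2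
      - μ * ‖matVec (B k ω) (y₁ - y₂) + matVec (C k ω) (z₁ - z₂)‖ ^ 2

/-- `y'_{k+1} = E[y_{k+1} | 𝓕_{k-1}]`. -/
noncomputable def condY (P : Measure Ω) (ℱ : Filtration ℕ mΩ) (y : ℕ → Ω → Vec n) (k : ℕ) :
    Ω → Vec n :=
  P[y (k + 1) | ℱ k]

/-- `z'_{k+1} = E[y_{k+1} w_k | 𝓕_{k-1}]`. -/
noncomputable def condZ (P : Measure Ω) (ℱ : Filtration ℕ mΩ) (w : ℕ → Ω → ℝ)
    (y : ℕ → Ω → Vec n) (k : ℕ) : Ω → Vec n :=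
  P[fun ω => w k ω • y (k + 1) ω | ℱ k]

/-- `(x, y)` is a solution in the weighted space of the forward-backward equation
`x_{k+1} = b(k, θ_k) + σ(k, θ_k) w_k`, `y_k = - f(k+1, θ_k)`, `x_0 = Λ(y_0)`, where
`θ_k = (x_k, y'_{k+1}, z'_{k+1})`. -/
structure IsSolution (P : Measure Ω) (ℱ : Filtration ℕ mΩ) (w : ℕ → Ω → ℝ) (ρ : ℝ)
    (Φ : Coefficients Ω n) (x y : ℕ → Ω → Vec n) : Prop where
  memL2_x : MemL2 P ℱ ρ x
  memL2_y : MemL2 P ℱ ρ y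
  forward : ∀ k, ∀ᵐ ω ∂P, x (k + 1) ω =
    Φ.b k ω (x k ω) (condY P ℱ y k ω) (condZ P ℱ w y k ω)
      + w k ω • Φ.σ k ω (x k ω) (condY P ℱ y k ω) (condZ P ℱ w y k ω)
  backward : ∀ k, ∀ᵐ ω ∂P, y k ω =
    -Φ.f (k + 1) ω (x k ω) (condY P ℱ y k ω) (condZ P ℱ w y k ω)
  initial : ∀ᵐ ω ∂P, x 0 ω = Φ.Λ (y 0 ω)

/-- `E[I]`, the expected size of the coefficients at the origin. -/
noncomputable def dataSize (P : Measure Ω) (ρ : ℝ) (Φ : Coefficients Ω n) : ℝ≥0∞ :=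
  ∫⁻ ω, ((∑' k : ℕ, ENNReal.ofReal (Real.exp (-ρ * k)) * ‖Φ.b k ω 0 0 0‖ₑ ^ 2)
    + (∑' k : ℕ, ENNReal.ofReal (Real.exp (-ρ * k)) * ‖Φ.σ k ω 0 0 0‖ₑ ^ 2)
    + (∑' k : ℕ, ENNReal.ofReal (Real.exp (-ρ * (k + 1))) * ‖Φ.f (k + 1) ω 0 0 0‖ₑ ^ 2)
    + ‖Φ.Λ 0‖ₑ ^ 2) ∂P

/-- `E[Î]`, the expected size of the difference of the coefficients `Φ` and `Φ'` along the
process `θ'_k = (x_k, y'_{k+1}, z'_{k+1})` built from `(x, y)`. -/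
noncomputable def dataDiff (P : Measure Ω) (ℱ : Filtration ℕ mΩ) (w : ℕ → Ω → ℝ) (ρ : ℝ)
    (Φ Φ' : Coefficients Ω n) (x y : ℕ → Ω → Vec n) : ℝ≥0∞ :=
  ∫⁻ ω, ((∑' k : ℕ, ENNReal.ofReal (Real.exp (-ρ * k)) *
        ‖Φ.b k ω (x k ω) (condY P ℱ y k ω) (condZ P ℱ w y k ω)
          - Φ'.b k ω (x k ω) (condY P ℱ y k ω) (condZ P ℱ w y k ω)‖ₑ ^ 2)
    + (∑' k : ℕ, ENNReal.ofReal (Real.exp (-ρ * k)) *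
        ‖Φ.σ k ω (x k ω) (condY P ℱ y k ω) (condZ P ℱ w y k ω)
          - Φ'.σ k ω (x k ω) (condY P ℱ y k ω) (condZ P ℱ w y k ω)‖ₑ ^ 2)
    + (∑' k : ℕ, ENNReal.ofReal (Real.exp (-ρ * (k + 1))) *
        ‖Φ.f (k + 1) ω (x k ω) (condY P ℱ y k ω) (condZ P ℱ w y k ω)
          - Φ'.f (k + 1) ω (x k ω) (condY P ℱ y k ω) (condZ P ℱ w y k ω)‖ₑ ^ 2)
    + ‖Φ.Λ (y 0 ω) - Φ'.Λ (y 0 ω)‖ₑ ^ 2) ∂P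

end Equation

/-!
The weighted space `L^{2,ρ}` is realised as a Hilbert space `H` (`StageL2`): the adapted elements of
`L²(ℕ × Ω)` for the measure `∑ₖ e^{-ρ k} δₖ ⊗ P`. On `H` there are two shifts,
`(S₁ u)ₖ₊₁ = uₖ` and `(S₂ v)ₖ₊₁ = wₖ vₖ`. Since `w` is a martingale difference sequence with unit
conditional variance, `‖S₁ u + S₂ v‖² = e^{-ρ} (‖u‖² + ‖v‖²)` (`norm_sq_shift_add_shift`), and by
duality `e^{ρ} S₁* y` and `e^{ρ} S₂* y` are the conditional expectations `y'` and `z'`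
(`condExp_ae_eq_scaledAdjoint_shift`). Hence the forward-backward equation is the fixed point equation
`x = S₁ b(θ) + S₂ σ(θ) + Λ(y)`, `y = -f(θ)` in `H × H`, where `b`, `σ`, `f`, `Λ` act as superposition
operators (`LipschitzAssumption.eq_rhs_iff`).

The core is an a priori estimate. For the difference of two approximate solutions, pairing the first
equation with `y` and the second one with `x` cancels everything except the monotonicity expression
and the residuals (`rhs_inner_identity`), so the monotonicity defect is bounded by the residuals. The
domination conditions convert this defect into a bound for the way `b`, `σ`, `Λ` depend on `y` (if
`μ > 0`), or for the way `f` depends on `x` (if `ν > 0`). One of the two unknowns is thereby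
decoupled from the other, and the bounds `4 L₁² e^{-ρ} < 1` and `6 L₂² e^{ρ} < 1` make both equations
contractive up to a fixed margin (`forward_estimate`, `backward_estimate`). Because of this margin the
constants do not depend on `ρ`.

The estimate holds with the same constant for the coefficients multiplied by any `α ∈ [0, 1]`: the
factor `α` in the defect matches the factor `α²` that is needed. The method of continuation, starting
from the identity at `α = 0`, therefore gives existence (`exists_eq_rhs`). Uniqueness, the growth
bound and the stability bound are instances of the estimate, comparing the solution with another
solution, with zero, and with the solution for the other coefficients.
-/

/-! ### The method of continuation -/

section Continuation

variable {E : Type*} [NormedAddCommGroup E] [NormedSpace ℝ E] [CompleteSpace E]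

/-- The method of continuation: if `G` is Lipschitz and the maps `id - α • G`, `0 ≤ α ≤ 1`, expand
distances by a common factor, then `id - G` is onto. The values `α = j / N` are reached one after
the other; each step of length `1 / N < 1 / (K * C)` is a contraction. -/
theorem exists_sub_apply_eq_of_uniform_estimate {G : E → E} {C K : ℝ} (hK : 0 < K) (hC : 0 < C)
    (hG : ∀ u v, ‖G u - G v‖ ≤ C * ‖u - v‖)
    (hest : ∀ α : ℝ, 0 ≤ α → α ≤ 1 → ∀ u v, ‖u - v‖ ≤ K * ‖(u - α • G u) - (v - α • G v)‖)
    (c : E) : ∃ u, u - G u = c := by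
  obtain ⟨N, hN⟩ := exists_nat_gt (K * C)
  have hNpos : (0 : ℝ) < N := (mul_pos hK hC).trans hN
  have key : ∀ j : ℕ, j ≤ N → ∀ c : E, ∃ u, u - ((j : ℝ) / N) • G u = c := by
    intro j
    induction j with
    | zero => intro _ c; exact ⟨c, by simp⟩
    | succ j ih =>
      intro hj c
      have hα1 : (j : ℝ) / N ≤ 1 := by
        rw [div_le_one hNpos]; exact_mod_cast (Nat.le_succ j).trans hj
      have hest' := hest ((j : ℝ) / N) (by positivity) hα1
      -- `T v` solves the equation for `j / N` with the increment of `α` evaluated at `v`; a fixed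
      -- point of `T` solves the equation for `(j + 1) / N`.
      choose T hT using fun v => ih ((Nat.le_succ j).trans hj) (c + (1 / (N : ℝ)) • G v)
      have hlip : ∀ u v, dist (T u) (T v) ≤ (K * C / N) * dist u v := by
        intro u v
        rw [dist_eq_norm, dist_eq_norm]
        refine (hest' _ _).trans ?_
        rw [hT, hT, add_sub_add_left_eq_sub, ← smul_sub, norm_smul, Real.norm_of_nonneg (by positivity)]
        calc K * (1 / N * ‖G u - G v‖) ≤ K * (1 / N * (C * ‖u - v‖)) := by gcongr; exact hG u v
          _ = _ := by ring
      have hcontr : ContractingWith (K * C / N).toNNReal T := by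
        constructor
        · rw [← Real.toNNReal_one]
          exact (Real.toNNReal_lt_toNNReal_iff one_pos).2 ((div_lt_one hNpos).2 hN)
        · refine LipschitzWith.of_dist_le_mul fun u v => ?_
          rw [Real.coe_toNNReal _ (by positivity)]
          exact hlip u v
      refine ⟨hcontr.fixedPoint T, ?_⟩
      have h1 := hT (hcontr.fixedPoint T)
      rw [hcontr.fixedPoint_isFixedPt] at h1
      rw [← sub_eq_iff_eq_add] at h1
      rw [← h1]
      push_cast
      module
  obtain ⟨u, hu⟩ := key N le_rfl c
  exact ⟨u, by simpa [div_self hNpos.ne'] using hu⟩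

end Continuation

/-! ### Scalar inequalities behind the a priori estimate -/

/-- A bound on `X + Y` from a quadratic bound on `X`, in which the unknowns enter the right-hand side
only multiplied by the size `s` of the data, and a linear bound of `Y` by `X`. -/
theorem add_le_of_sq_le {X Y s a c : ℝ} (hs : 0 ≤ s) (ha : 0 ≤ a) (hc : 0 ≤ c)
    (hX : X ^ 2 ≤ a * (s * (X + Y)) + a * s ^ 2) (hY : Y ≤ c * (X + s)) :
    X + Y ≤ ((1 + c) * (a * (1 + c) + 1) + c) * s := by
  have h1 : X ^ 2 ≤ a * (1 + c) * s * X + a * (1 + c) * s ^ 2 := by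
    have : a * s * Y ≤ a * s * (c * (X + s)) := by gcongr
    nlinarith
  have hA : 0 ≤ a * (1 + c) := by positivity
  generalize a * (1 + c) = A at *
  have h2 : X ≤ (A + 1) * s := by
    by_contra! h
    nlinarith [mul_nonneg hA hs, mul_nonneg hs hs, mul_nonneg hA (mul_nonneg hs hs)]
  nlinarith

/-- The numerical content of `forward_estimate`. Here `X`, `Y` are the norms of the differences of the
two components, `p`, `q` those of the residuals, and `hm` is the consequence of monotonicity. -/
theorem forward_scalar_bound {α β l p q X Y A B F k c₀ c : ℝ} (hα : 0 ≤ α) (hα' : α ≤ 1)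
    (hβ : 0 ≤ β) (hl : 0 ≤ l) (hp : 0 ≤ p) (hq : 0 ≤ q) (hX : 0 ≤ X) (hY : 0 ≤ Y) (hk : 0 < k)
    (hc₀ : 0 < c₀) (hc : 0 < c) (hB0 : 0 ≤ B) (hF0 : 0 ≤ F) (hA : A ≤ c₀ * β) (hB : B ≤ 3 / 4 * X)
    (hF : F ≤ c * X + 3 / 4 * Y) (hx : X ≤ α * A + α * B + α * l + p) (hy : Y ≤ α * F + q)
    (hm : α * (β ^ 2 + l ^ 2) ≤ k * (X * q + p * Y)) :
    X + Y ≤ ((1 + 4 * (c + 1)) * (48 * (c₀ + 1) ^ 2 * (k + 1) * (1 + 4 * (c + 1)) + 1)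
      + 4 * (c + 1)) * (p + q) := by
  apply add_le_of_sq_le (by positivity) (by positivity) (by positivity)
  · have h1 : X ≤ 4 * (c₀ + 1) * (α * β + α * l + p) := by
      have e1 : α * A ≤ α * (c₀ * β) := by gcongr
      have e3 : α * B ≤ 1 * (3 / 4 * X) := by gcongr
      have e4 : 0 ≤ c₀ * (α * l) := by positivity
      have e5 : 0 ≤ c₀ * p := by positivity
      have e6 : 0 ≤ α * β := by positivity
      linarith
    have h2 : X ^ 2 ≤ (4 * (c₀ + 1)) ^ 2 * (3 * (α * (β ^ 2 + l ^ 2) + p ^ 2)) := by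
      have e1 : (α * β + α * l + p) ^ 2 ≤ 3 * ((α * β) ^ 2 + (α * l) ^ 2 + p ^ 2) := by
        linarith [sq_nonneg (α * β - α * l), sq_nonneg (α * β - p), sq_nonneg (α * l - p)]
      have e2 : α ^ 2 ≤ α := pow_le_of_le_one hα hα' two_ne_zero
      calc X ^ 2 ≤ (4 * (c₀ + 1) * (α * β + α * l + p)) ^ 2 := by gcongr
        _ = (4 * (c₀ + 1)) ^ 2 * (α * β + α * l + p) ^ 2 := by ring
        _ ≤ (4 * (c₀ + 1)) ^ 2 * (3 * ((α * β) ^ 2 + (α * l) ^ 2 + p ^ 2)) := by gcongr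
        _ = (4 * (c₀ + 1)) ^ 2 * (3 * (α ^ 2 * (β ^ 2 + l ^ 2) + p ^ 2)) := by ring
        _ ≤ _ := by gcongr
    have h3 : α * (β ^ 2 + l ^ 2) + p ^ 2 ≤ (k + 1) * ((p + q) * (X + Y) + (p + q) ^ 2) := by
      have e1 : k * (X * q + p * Y) ≤ k * ((p + q) * (X + Y) + (p + q) ^ 2) := by
        refine mul_le_mul_of_nonneg_left ?_ hk.le
        nlinarith [mul_nonneg hX hp, mul_nonneg hY hq, sq_nonneg (p + q)]
      have e2 : p ^ 2 ≤ (p + q) * (X + Y) + (p + q) ^ 2 := by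
        have : 0 ≤ (p + q) * (X + Y) := by positivity
        nlinarith [mul_nonneg hp hq, sq_nonneg q]
      linarith
    calc X ^ 2 ≤ (4 * (c₀ + 1)) ^ 2 * (3 * ((k + 1) * ((p + q) * (X + Y) + (p + q) ^ 2))) := by
          refine h2.trans ?_; gcongr
      _ = _ := by ring
  · have e2 : α * F ≤ 1 * (c * X + 3 / 4 * Y) := by gcongr
    have e3 : 0 ≤ c * (p + q) := by positivity
    linarith

/-- The numerical content of `backward_estimate`, with the roles of the two components exchanged with
respect to `forward_scalar_bound`. -/
theorem backward_scalar_bound {α φ p q X Y A B F l k c : ℝ} (hα : 0 ≤ α) (hα' : α ≤ 1)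
    (hp : 0 ≤ p) (hq : 0 ≤ q) (hX : 0 ≤ X) (hY : 0 ≤ Y) (hk : 0 < k)
    (hc : 0 < c) (hA0 : 0 ≤ A) (hl0 : 0 ≤ l) (hB0 : 0 ≤ B) (hF0 : 0 ≤ F) (hA : A + l ≤ c * Y)
    (hB : B ≤ 3 / 4 * X)
    (hF : F ≤ 3 / 4 * Y) (hx : X ≤ α * A + α * B + α * l + p) (hy : Y ≤ α * φ + α * F + q)
    (hm : α * φ ^ 2 ≤ k * (X * q + p * Y)) :
    X + Y ≤ ((1 + 4 * (c + 1)) * (32 * (k + 1) * (1 + 4 * (c + 1)) + 1)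
      + 4 * (c + 1)) * (p + q) := by
  rw [add_comm X]
  apply add_le_of_sq_le (by positivity) (by positivity) (by positivity)
  · have h1 : Y ≤ 4 * (α * φ + q) := by
      have e3 : α * F ≤ 1 * (3 / 4 * Y) := by gcongr
      linarith
    have h2 : Y ^ 2 ≤ 32 * (α * φ ^ 2 + q ^ 2) := by
      have e2 : α ^ 2 ≤ α := pow_le_of_le_one hα hα' two_ne_zero
      calc Y ^ 2 ≤ (4 * (α * φ + q)) ^ 2 := by gcongr
        _ ≤ 32 * (α ^ 2 * φ ^ 2 + q ^ 2) := by linarith [sq_nonneg (α * φ - q)]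
        _ ≤ _ := by gcongr
    have h3 : α * φ ^ 2 + q ^ 2 ≤ (k + 1) * ((p + q) * (Y + X) + (p + q) ^ 2) := by
      have e1 : k * (X * q + p * Y) ≤ k * ((p + q) * (Y + X) + (p + q) ^ 2) := by
        refine mul_le_mul_of_nonneg_left ?_ hk.le
        nlinarith [mul_nonneg hX hp, mul_nonneg hY hq, sq_nonneg (p + q)]
      have e2 : q ^ 2 ≤ (p + q) * (Y + X) + (p + q) ^ 2 := by
        have : 0 ≤ (p + q) * (Y + X) := by positivity
        nlinarith [mul_nonneg hp hq, sq_nonneg p]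
      linarith
    calc Y ^ 2 ≤ 32 * ((k + 1) * ((p + q) * (Y + X) + (p + q) ^ 2)) := by
          refine h2.trans ?_; gcongr
      _ = _ := by ring
  · have e1 : α * (A + l) ≤ 1 * (c * Y) := by gcongr
    have e2 : α * B ≤ 1 * (3 / 4 * X) := by gcongr
    have e3 : 0 ≤ c * (p + q) := by positivity
    linarith

/-! ### The coupled system in a Hilbert space -/

section HilbertSpace

/-- Coefficients of the coupled equation acting on a Hilbert space `H` of whole processes. The maps
`b`, `σ`, `f` take the three components of `θ = (x, y', z')`. -/
structure HilbertCoefficients (H : Type*) where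
  Λ : H → H
  b : H → H → H → H
  σ : H → H → H → H
  f : H → H → H → H

variable {H : Type*} [NormedAddCommGroup H] [InnerProductSpace ℝ H]

/-- The Lipschitz conditions with the constants `ℓ`, for coefficients on `H`. -/
structure HilbertCoefficients.IsLipschitz (Ψ : HilbertCoefficients H) (ℓ : LipschitzConstants) :
    Prop where
  lip_Λ : ∀ y₁ y₂, ‖Ψ.Λ y₁ - Ψ.Λ y₂‖ ≤ ℓ.L * ‖y₁ - y₂‖
  lip_b : ∀ x₁ x₂ y₁ y₂ z₁ z₂, ‖Ψ.b x₁ y₁ z₁ - Ψ.b x₂ y₂ z₂‖ ≤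
    ℓ.L₁ * ‖x₁ - x₂‖ + ℓ.L₃ * ‖y₁ - y₂‖ + ℓ.L₄ * ‖z₁ - z₂‖
  lip_σ : ∀ x₁ x₂ y₁ y₂ z₁ z₂, ‖Ψ.σ x₁ y₁ z₁ - Ψ.σ x₂ y₂ z₂‖ ≤
    ℓ.L₁ * ‖x₁ - x₂‖ + ℓ.L₅ * ‖y₁ - y₂‖ + ℓ.L₆ * ‖z₁ - z₂‖
  lip_f : ∀ x₁ x₂ y₁ y₂ z₁ z₂, ‖Ψ.f x₁ y₁ z₁ - Ψ.f x₂ y₂ z₂‖ ≤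
    ℓ.L₇ * ‖x₁ - x₂‖ + ℓ.L₂ * (‖y₁ - y₂‖ + ‖z₁ - z₂‖)

/-- Monotonicity with a defect that controls the dependence of the forward coefficients on `y`: the
domination conditions for `μ > 0` turn the terms `|M ŷ|²` and `|B ŷ' + C ẑ'|²` into these, so that
the matrices disappear. The weight `r` stands for `e^{-ρ}`. -/
structure HilbertCoefficients.ForwardMonotone (Ψ : HilbertCoefficients H) (r κ : ℝ) :
    Prop where
  mono_Λ : ∀ y₁ y₂, inner ℝ (Ψ.Λ y₁ - Ψ.Λ y₂) (y₁ - y₂) ≤ -κ * ‖Ψ.Λ y₁ - Ψ.Λ y₂‖ ^ 2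
  mono : ∀ x₁ x₂ y₁ y₂ z₁ z₂,
    inner ℝ (Ψ.f x₁ y₁ z₁ - Ψ.f x₂ y₂ z₂) (x₁ - x₂)
      + r * inner ℝ (Ψ.b x₁ y₁ z₁ - Ψ.b x₂ y₂ z₂) (y₁ - y₂)
      + r * inner ℝ (Ψ.σ x₁ y₁ z₁ - Ψ.σ x₂ y₂ z₂) (z₁ - z₂)
    ≤ -κ * (‖Ψ.b x₁ y₁ z₁ - Ψ.b x₁ y₂ z₂‖ ^ 2 + ‖Ψ.σ x₁ y₁ z₁ - Ψ.σ x₁ y₂ z₂‖ ^ 2)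

/-- Monotonicity with a defect that controls the dependence of the backward coefficient on `x`; it
arises from the domination condition for `ν > 0`. -/
structure HilbertCoefficients.BackwardMonotone (Ψ : HilbertCoefficients H) (r κ : ℝ) :
    Prop where
  mono_Λ : ∀ y₁ y₂, inner ℝ (Ψ.Λ y₁ - Ψ.Λ y₂) (y₁ - y₂) ≤ 0
  mono : ∀ x₁ x₂ y₁ y₂ z₁ z₂,
    inner ℝ (Ψ.f x₁ y₁ z₁ - Ψ.f x₂ y₂ z₂) (x₁ - x₂)
      + r * inner ℝ (Ψ.b x₁ y₁ z₁ - Ψ.b x₂ y₂ z₂) (y₁ - y₂)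
      + r * inner ℝ (Ψ.σ x₁ y₁ z₁ - Ψ.σ x₂ y₂ z₂) (z₁ - z₂)
    ≤ -κ * ‖Ψ.f x₁ y₁ z₁ - Ψ.f x₂ y₁ z₁‖ ^ 2


/-- A bound for the joint shift `S₁ u + S₂ v` of a pair `(u, v)` whose joint norm is at most `B`. -/
theorem norm_shift_le {t : ℝ} (ht : 0 < t) {S₁ S₂ : H →L[ℝ] H}
    (hS : ∀ u v, ‖S₁ u + S₂ v‖ ^ 2 = t ^ 2 * (‖u‖ ^ 2 + ‖v‖ ^ 2)) {u v : H} {B : ℝ} (hB : 0 ≤ B)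
    (h : ‖u‖ ^ 2 + ‖v‖ ^ 2 ≤ B ^ 2) : ‖S₁ u + S₂ v‖ ≤ t * B := by
  refine le_of_sq_le_sq ?_ (by positivity)
  rw [hS, mul_pow]
  gcongr

theorem neg_le_rhs_inner (u v d : H × H) :
    -(‖u.1 - v.1‖ * ‖d.2‖ + ‖d.1‖ * ‖u.2 - v.2‖) ≤
      inner ℝ (u.1 - v.1) d.2 - inner ℝ d.1 (u.2 - v.2) := by
  have h1 := neg_le_of_abs_le (abs_real_inner_le_norm (u.1 - v.1) d.2)
  have h2 := real_inner_le_norm d.1 (u.2 - v.2)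
  linarith

variable [CompleteSpace H]

/-- The adjoint of `S` divided by `r`. For the two shifts of processes and `r = e^{-ρ}` these are
the conditional expectations `y'` and `z'` of `y`. -/
noncomputable def scaledAdjoint (r : ℝ) (S : H →L[ℝ] H) : H →L[ℝ] H :=
  r⁻¹ • S.adjoint

theorem mul_inner_scaledAdjoint {r : ℝ} (hr : 0 < r) (S : H →L[ℝ] H) (u y : H) :
    r * inner ℝ u (scaledAdjoint r S y) = inner ℝ (S u) y := by
  rw [scaledAdjoint, _root_.smul_apply, inner_smul_right,
    ContinuousLinearMap.adjoint_inner_right]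
  field_simp

/-- The abstract Bessel inequality for the two scaled adjoints. It holds with factor `√2`, here
rounded up to `3 / 2`. -/
theorem norm_scaledAdjoint_add_le {t : ℝ} (ht : 0 < t) {S₁ S₂ : H →L[ℝ] H}
    (hS : ∀ u v, ‖S₁ u + S₂ v‖ ^ 2 = t ^ 2 * (‖u‖ ^ 2 + ‖v‖ ^ 2)) (y : H) :
    t * (‖scaledAdjoint (t ^ 2) S₁ y‖ + ‖scaledAdjoint (t ^ 2) S₂ y‖) ≤ 3 / 2 * ‖y‖ := by
  have h1 := mul_inner_scaledAdjoint (pow_pos ht 2) S₁ (scaledAdjoint (t ^ 2) S₁ y) y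
  have h2 := mul_inner_scaledAdjoint (pow_pos ht 2) S₂ (scaledAdjoint (t ^ 2) S₂ y) y
  rw [real_inner_self_eq_norm_sq] at h1 h2
  generalize scaledAdjoint (t ^ 2) S₁ y = u at *
  generalize scaledAdjoint (t ^ 2) S₂ y = v at *
  have h3 : t ^ 2 * (‖u‖ ^ 2 + ‖v‖ ^ 2) ≤ ‖S₁ u + S₂ v‖ * ‖y‖ := by
    rw [mul_add, h1, h2, ← inner_add_left]
    exact real_inner_le_norm _ _
  have h4 : ‖S₁ u + S₂ v‖ ≤ ‖y‖ := by
    rw [← hS] at h3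
    by_contra! h
    nlinarith [norm_nonneg y, norm_nonneg (S₁ u + S₂ v)]
  have h5 : t ^ 2 * (‖u‖ ^ 2 + ‖v‖ ^ 2) ≤ ‖y‖ ^ 2 := by
    rw [← hS]; gcongr
  refine le_of_sq_le_sq ?_ (by positivity)
  nlinarith [sq_nonneg (t * (‖u‖ - ‖v‖)), sq_nonneg (‖y‖)]

/-- The right-hand side of the coupled system: its solutions are the fixed points
`(x, y) = rhs (x, y)`. The initial condition is part of the first component, as `Λ` takes values in
processes supported at time `0`. -/
noncomputable def HilbertCoefficients.rhs (Ψ : HilbertCoefficients H) (r : ℝ) (S₁ S₂ : H →L[ℝ] H)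
    (u : H × H) : H × H :=
  (S₁ (Ψ.b u.1 (scaledAdjoint r S₁ u.2) (scaledAdjoint r S₂ u.2))
      + S₂ (Ψ.σ u.1 (scaledAdjoint r S₁ u.2) (scaledAdjoint r S₂ u.2)) + Ψ.Λ u.2,
    -Ψ.f u.1 (scaledAdjoint r S₁ u.2) (scaledAdjoint r S₂ u.2))

/-- The constant of `forward_estimate`. -/
noncomputable def forwardConst (ℓ : LipschitzConstants) (κ : ℝ) : ℝ :=
  (1 + 4 * (ℓ.L₇ + 1)) * (48 * (1 / (2 * ℓ.L₁) + 1) ^ 2 * (1 / κ + 1) * (1 + 4 * (ℓ.L₇ + 1)) + 1)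
    + 4 * (ℓ.L₇ + 1)

/-- The constant of `backward_estimate`. -/
noncomputable def backwardConst (ℓ : LipschitzConstants) (κ : ℝ) : ℝ :=
  let c := 3 / 2 * (ℓ.L₃ + ℓ.L₄ + ℓ.L₅ + ℓ.L₆) + ℓ.L
  (1 + 4 * (c + 1)) * (32 * (1 / κ + 1) * (1 + 4 * (c + 1)) + 1) + 4 * (c + 1)

variable {Ψ : HilbertCoefficients H} {ℓ : LipschitzConstants} {t κ : ℝ} {S₁ S₂ : H →L[ℝ] H}

/-- The duality identity: the scaled adjoints turn the pairing of `b`, `σ` with `y'`, `z'` into the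
pairing of the first component of `rhs` with `y`, so that all terms except the residuals of `u` and
`v` cancel. -/
theorem rhs_inner_identity (ht : 0 < t) (α : ℝ) (u v : H × H) :
    α * (inner ℝ (Ψ.f u.1 (scaledAdjoint (t ^ 2) S₁ u.2) (scaledAdjoint (t ^ 2) S₂ u.2)
        - Ψ.f v.1 (scaledAdjoint (t ^ 2) S₁ v.2) (scaledAdjoint (t ^ 2) S₂ v.2)) (u.1 - v.1)
      + t ^ 2 * inner ℝ (Ψ.b u.1 (scaledAdjoint (t ^ 2) S₁ u.2) (scaledAdjoint (t ^ 2) S₂ u.2)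
        - Ψ.b v.1 (scaledAdjoint (t ^ 2) S₁ v.2) (scaledAdjoint (t ^ 2) S₂ v.2))
        (scaledAdjoint (t ^ 2) S₁ u.2 - scaledAdjoint (t ^ 2) S₁ v.2)
      + t ^ 2 * inner ℝ (Ψ.σ u.1 (scaledAdjoint (t ^ 2) S₁ u.2) (scaledAdjoint (t ^ 2) S₂ u.2)
        - Ψ.σ v.1 (scaledAdjoint (t ^ 2) S₁ v.2) (scaledAdjoint (t ^ 2) S₂ v.2))
        (scaledAdjoint (t ^ 2) S₂ u.2 - scaledAdjoint (t ^ 2) S₂ v.2)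
      + inner ℝ (Ψ.Λ u.2 - Ψ.Λ v.2) (u.2 - v.2))
    = inner ℝ (u.1 - v.1) ((u - α • Ψ.rhs (t ^ 2) S₁ S₂ u) - (v - α • Ψ.rhs (t ^ 2) S₁ S₂ v)).2
      - inner ℝ ((u - α • Ψ.rhs (t ^ 2) S₁ S₂ u) - (v - α • Ψ.rhs (t ^ 2) S₁ S₂ v)).1
        (u.2 - v.2) := by
  rw [← map_sub, ← map_sub, mul_inner_scaledAdjoint (pow_pos ht 2),
    mul_inner_scaledAdjoint (pow_pos ht 2)]
  have h1 : ((u - α • Ψ.rhs (t ^ 2) S₁ S₂ u) - (v - α • Ψ.rhs (t ^ 2) S₁ S₂ v)).1 =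
      (u.1 - v.1) - α • (S₁ (Ψ.b u.1 (scaledAdjoint (t ^ 2) S₁ u.2) (scaledAdjoint (t ^ 2) S₂ u.2)
        - Ψ.b v.1 (scaledAdjoint (t ^ 2) S₁ v.2) (scaledAdjoint (t ^ 2) S₂ v.2))
        + S₂ (Ψ.σ u.1 (scaledAdjoint (t ^ 2) S₁ u.2) (scaledAdjoint (t ^ 2) S₂ u.2)
        - Ψ.σ v.1 (scaledAdjoint (t ^ 2) S₁ v.2) (scaledAdjoint (t ^ 2) S₂ v.2))
        + (Ψ.Λ u.2 - Ψ.Λ v.2)) := by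
    simp only [HilbertCoefficients.rhs, Prod.fst_sub, Prod.smul_fst, map_sub]
    module
  have h2 : ((u - α • Ψ.rhs (t ^ 2) S₁ S₂ u) - (v - α • Ψ.rhs (t ^ 2) S₁ S₂ v)).2 =
      (u.2 - v.2) + α • (Ψ.f u.1 (scaledAdjoint (t ^ 2) S₁ u.2) (scaledAdjoint (t ^ 2) S₂ u.2)
        - Ψ.f v.1 (scaledAdjoint (t ^ 2) S₁ v.2) (scaledAdjoint (t ^ 2) S₂ v.2)) := by
    simp only [HilbertCoefficients.rhs, Prod.snd_sub, Prod.smul_snd]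
    module
  rw [h1, h2, real_inner_comm (u.1 - v.1)]
  simp only [inner_sub_left _ (α • _), inner_add_left, inner_add_right, inner_smul_left,
    inner_smul_right, RCLike.conj_to_real]
  ring

/-- Monotonicity inserted into the duality identity: the defect `D` is bounded by the residuals. -/
theorem le_of_inner_identity {α κ D I p q X Y : ℝ} (hα : 0 ≤ α) (hκ : 0 < κ)
    (hI : I ≤ -κ * D) (h : -(X * q + p * Y) ≤ α * I)  :
    α * D ≤ 1 / κ * (X * q + p * Y) := by
  rw [one_div, ← div_eq_inv_mul, le_div_iff₀ hκ]
  nlinarith [mul_le_mul_of_nonneg_left hI hα]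

/-- Stability of `id - α • rhs`, uniformly in `α ∈ [0, 1]`, when the monotonicity defect controls the
dependence of `b`, `σ`, `Λ` on `y`: this bounds `x` by the defect, and `y` is bounded by `x` through
the backward equation. -/
theorem forward_estimate (ht : 0 < t) (hL₁ : 2 * ℓ.L₁ * t ≤ 1) (hL₂ : 2 * ℓ.L₂ ≤ t) (hκ : 0 < κ)
    (hS : ∀ u v, ‖S₁ u + S₂ v‖ ^ 2 = t ^ 2 * (‖u‖ ^ 2 + ‖v‖ ^ 2))
    (hΨ : Ψ.IsLipschitz ℓ) (hm : Ψ.ForwardMonotone (t ^ 2) κ) {α : ℝ} (hα : 0 ≤ α) (hα' : α ≤ 1)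
    (u v : H × H) :
    ‖u.1 - v.1‖ + ‖u.2 - v.2‖ ≤ forwardConst ℓ κ *
      (‖((u - α • Ψ.rhs (t ^ 2) S₁ S₂ u) - (v - α • Ψ.rhs (t ^ 2) S₁ S₂ v)).1‖ +
        ‖((u - α • Ψ.rhs (t ^ 2) S₁ S₂ u) - (v - α • Ψ.rhs (t ^ 2) S₁ S₂ v)).2‖) := by
  have hid := rhs_inner_identity (Ψ := Ψ) (S₁ := S₁) (S₂ := S₂) ht α u v
  have hneg := neg_le_rhs_inner u v
    ((u - α • Ψ.rhs (t ^ 2) S₁ S₂ u) - (v - α • Ψ.rhs (t ^ 2) S₁ S₂ v))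
  rw [← hid] at hneg
  have hD := norm_scaledAdjoint_add_le ht hS (u.2 - v.2)
  -- The increments of `b`, `σ` are split into one in `(y', z')`, controlled by the defect, and one
  -- in `x`, which the smallness of `L₁ t` makes contractive.
  have hp : u.1 - v.1 = α • (S₁ (Ψ.b u.1 (scaledAdjoint (t ^ 2) S₁ u.2)
        (scaledAdjoint (t ^ 2) S₂ u.2) - Ψ.b u.1 (scaledAdjoint (t ^ 2) S₁ v.2)
        (scaledAdjoint (t ^ 2) S₂ v.2))
      + S₂ (Ψ.σ u.1 (scaledAdjoint (t ^ 2) S₁ u.2) (scaledAdjoint (t ^ 2) S₂ u.2)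
        - Ψ.σ u.1 (scaledAdjoint (t ^ 2) S₁ v.2) (scaledAdjoint (t ^ 2) S₂ v.2)))
      + α • (S₁ (Ψ.b u.1 (scaledAdjoint (t ^ 2) S₁ v.2)
        (scaledAdjoint (t ^ 2) S₂ v.2) - Ψ.b v.1 (scaledAdjoint (t ^ 2) S₁ v.2)
        (scaledAdjoint (t ^ 2) S₂ v.2))
      + S₂ (Ψ.σ u.1 (scaledAdjoint (t ^ 2) S₁ v.2) (scaledAdjoint (t ^ 2) S₂ v.2)
        - Ψ.σ v.1 (scaledAdjoint (t ^ 2) S₁ v.2) (scaledAdjoint (t ^ 2) S₂ v.2)))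
      + α • (Ψ.Λ u.2 - Ψ.Λ v.2)
      + ((u - α • Ψ.rhs (t ^ 2) S₁ S₂ u) - (v - α • Ψ.rhs (t ^ 2) S₁ S₂ v)).1 := by
    simp only [HilbertCoefficients.rhs, Prod.fst_sub, Prod.smul_fst, map_sub]
    module
  have hq : u.2 - v.2 = -(α • (Ψ.f u.1 (scaledAdjoint (t ^ 2) S₁ u.2)
        (scaledAdjoint (t ^ 2) S₂ u.2) - Ψ.f v.1 (scaledAdjoint (t ^ 2) S₁ v.2)
        (scaledAdjoint (t ^ 2) S₂ v.2)))
      + ((u - α • Ψ.rhs (t ^ 2) S₁ S₂ u) - (v - α • Ψ.rhs (t ^ 2) S₁ S₂ v)).2 := by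
    simp only [HilbertCoefficients.rhs, Prod.snd_sub, Prod.smul_snd]
    module
  rw [map_sub, map_sub] at hD
  generalize scaledAdjoint (t ^ 2) S₁ u.2 = y₁ at *
  generalize scaledAdjoint (t ^ 2) S₁ v.2 = y₂ at *
  generalize scaledAdjoint (t ^ 2) S₂ u.2 = z₁ at *
  generalize scaledAdjoint (t ^ 2) S₂ v.2 = z₂ at *
  generalize ((u - α • Ψ.rhs (t ^ 2) S₁ S₂ u) - (v - α • Ψ.rhs (t ^ 2) S₁ S₂ v)) = d at *
  have hb := hΨ.lip_b u.1 v.1 y₂ y₂ z₂ z₂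
  have hσ := hΨ.lip_σ u.1 v.1 y₂ y₂ z₂ z₂
  have hf := hΨ.lip_f u.1 v.1 y₁ y₂ z₁ z₂
  simp only [sub_self, norm_zero, mul_zero, add_zero] at hb hσ
  have hmono := le_of_inner_identity hα hκ (D := (‖Ψ.b u.1 y₁ z₁ - Ψ.b u.1 y₂ z₂‖ ^ 2
    + ‖Ψ.σ u.1 y₁ z₁ - Ψ.σ u.1 y₂ z₂‖ ^ 2) + ‖Ψ.Λ u.2 - Ψ.Λ v.2‖ ^ 2)
    (by linarith [hm.mono u.1 v.1 y₁ y₂ z₁ z₂, hm.mono_Λ u.2 v.2]) hneg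
  have hx1 := norm_shift_le ht hS (u := Ψ.b u.1 y₁ z₁ - Ψ.b u.1 y₂ z₂)
    (v := Ψ.σ u.1 y₁ z₁ - Ψ.σ u.1 y₂ z₂) (Real.sqrt_nonneg _) (Real.sq_sqrt (by positivity)).ge
  have hL1 := ℓ.L₁_pos
  have hL2 := ℓ.L₂_pos
  have hL7 := ℓ.L₇_pos
  have hx2 := norm_shift_le ht hS (u := Ψ.b u.1 y₂ z₂ - Ψ.b v.1 y₂ z₂)
    (v := Ψ.σ u.1 y₂ z₂ - Ψ.σ v.1 y₂ z₂) (B := 3 / 2 * (ℓ.L₁ * ‖u.1 - v.1‖)) (by positivity) (by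
      linarith [pow_le_pow_left₀ (norm_nonneg _) hb 2, pow_le_pow_left₀ (norm_nonneg _) hσ 2,
        sq_nonneg (ℓ.L₁ * ‖u.1 - v.1‖)])
  set β := √(‖Ψ.b u.1 y₁ z₁ - Ψ.b u.1 y₂ z₂‖ ^ 2 + ‖Ψ.σ u.1 y₁ z₁ - Ψ.σ u.1 y₂ z₂‖ ^ 2) with hβ
  have hβ2 : β ^ 2 = ‖Ψ.b u.1 y₁ z₁ - Ψ.b u.1 y₂ z₂‖ ^ 2 + ‖Ψ.σ u.1 y₁ z₁ - Ψ.σ u.1 y₂ z₂‖ ^ 2 :=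
    Real.sq_sqrt (by positivity)
  have hβ0 : 0 ≤ β := Real.sqrt_nonneg _
  rw [← hβ2] at hmono
  have hxle := (congrArg norm hp).trans_le (norm_add₄_le ..)
  have hyle := (congrArg norm hq).trans_le (norm_add_le _ _)
  simp only [norm_neg, norm_smul, Real.norm_of_nonneg hα] at hxle hyle
  have hX := norm_nonneg (u.1 - v.1)
  have hY := norm_nonneg (u.2 - v.2)
  have hP := norm_nonneg d.1
  have hQ := norm_nonneg d.2
  have hl := norm_nonneg (Ψ.Λ u.2 - Ψ.Λ v.2)
  have hc₀ : 0 < 1 / (2 * ℓ.L₁) := by positivity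
  have htc : t ≤ 1 / (2 * ℓ.L₁) := by rw [le_div_iff₀ (by positivity)]; linarith
  refine forward_scalar_bound hα hα' hβ0 hl hP hQ hX hY (by positivity) hc₀ hL7 (norm_nonneg _)
    (norm_nonneg _) (hx1.trans (by gcongr)) (hx2.trans ?_) (hf.trans ?_) hxle hyle hmono
  · have := mul_le_mul_of_nonneg_right hL₁ hX
    linarith
  · have : 2 * ℓ.L₂ * (‖y₁ - y₂‖ + ‖z₁ - z₂‖) ≤ t * (‖y₁ - y₂‖ + ‖z₁ - z₂‖) := by gcongr
    linarith

/-- Stability of `id - α • rhs`, uniformly in `α ∈ [0, 1]`, when the monotonicity defect controls the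
dependence of `f` on `x`: this bounds `y` by the defect, and `x` is bounded by `y` through the
forward equation. -/
theorem backward_estimate (ht : 0 < t) (hL₁ : 2 * ℓ.L₁ * t ≤ 1) (hL₂ : 2 * ℓ.L₂ ≤ t) (hκ : 0 < κ)
    (hS : ∀ u v, ‖S₁ u + S₂ v‖ ^ 2 = t ^ 2 * (‖u‖ ^ 2 + ‖v‖ ^ 2))
    (hΨ : Ψ.IsLipschitz ℓ) (hm : Ψ.BackwardMonotone (t ^ 2) κ) {α : ℝ} (hα : 0 ≤ α) (hα' : α ≤ 1)
    (u v : H × H) :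
    ‖u.1 - v.1‖ + ‖u.2 - v.2‖ ≤ backwardConst ℓ κ *
      (‖((u - α • Ψ.rhs (t ^ 2) S₁ S₂ u) - (v - α • Ψ.rhs (t ^ 2) S₁ S₂ v)).1‖ +
        ‖((u - α • Ψ.rhs (t ^ 2) S₁ S₂ u) - (v - α • Ψ.rhs (t ^ 2) S₁ S₂ v)).2‖) := by
  have hid := rhs_inner_identity (Ψ := Ψ) (S₁ := S₁) (S₂ := S₂) ht α u v
  have hneg := neg_le_rhs_inner u v
    ((u - α • Ψ.rhs (t ^ 2) S₁ S₂ u) - (v - α • Ψ.rhs (t ^ 2) S₁ S₂ v))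
  rw [← hid] at hneg
  have hD := norm_scaledAdjoint_add_le ht hS (u.2 - v.2)
  -- The increments of `b`, `σ` in `(y', z')` are bounded by `y`; those in `x` are contractive by the
  -- smallness of `L₁ t`. The increment of `f` in `x` is controlled by the defect.
  have hp : u.1 - v.1 = α • (S₁ (Ψ.b u.1 (scaledAdjoint (t ^ 2) S₁ u.2)
        (scaledAdjoint (t ^ 2) S₂ u.2) - Ψ.b u.1 (scaledAdjoint (t ^ 2) S₁ v.2)
        (scaledAdjoint (t ^ 2) S₂ v.2))
      + S₂ (Ψ.σ u.1 (scaledAdjoint (t ^ 2) S₁ u.2) (scaledAdjoint (t ^ 2) S₂ u.2)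
        - Ψ.σ u.1 (scaledAdjoint (t ^ 2) S₁ v.2) (scaledAdjoint (t ^ 2) S₂ v.2)))
      + α • (S₁ (Ψ.b u.1 (scaledAdjoint (t ^ 2) S₁ v.2)
        (scaledAdjoint (t ^ 2) S₂ v.2) - Ψ.b v.1 (scaledAdjoint (t ^ 2) S₁ v.2)
        (scaledAdjoint (t ^ 2) S₂ v.2))
      + S₂ (Ψ.σ u.1 (scaledAdjoint (t ^ 2) S₁ v.2) (scaledAdjoint (t ^ 2) S₂ v.2)
        - Ψ.σ v.1 (scaledAdjoint (t ^ 2) S₁ v.2) (scaledAdjoint (t ^ 2) S₂ v.2)))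
      + α • (Ψ.Λ u.2 - Ψ.Λ v.2)
      + ((u - α • Ψ.rhs (t ^ 2) S₁ S₂ u) - (v - α • Ψ.rhs (t ^ 2) S₁ S₂ v)).1 := by
    simp only [HilbertCoefficients.rhs, Prod.fst_sub, Prod.smul_fst, map_sub]
    module
  have hq : u.2 - v.2 = -(α • (Ψ.f u.1 (scaledAdjoint (t ^ 2) S₁ u.2)
        (scaledAdjoint (t ^ 2) S₂ u.2) - Ψ.f v.1 (scaledAdjoint (t ^ 2) S₁ u.2)
        (scaledAdjoint (t ^ 2) S₂ u.2)))
      + -(α • (Ψ.f v.1 (scaledAdjoint (t ^ 2) S₁ u.2)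
        (scaledAdjoint (t ^ 2) S₂ u.2) - Ψ.f v.1 (scaledAdjoint (t ^ 2) S₁ v.2)
        (scaledAdjoint (t ^ 2) S₂ v.2)))
      + ((u - α • Ψ.rhs (t ^ 2) S₁ S₂ u) - (v - α • Ψ.rhs (t ^ 2) S₁ S₂ v)).2 := by
    simp only [HilbertCoefficients.rhs, Prod.snd_sub, Prod.smul_snd]
    module
  rw [map_sub, map_sub] at hD
  generalize scaledAdjoint (t ^ 2) S₁ u.2 = y₁ at *
  generalize scaledAdjoint (t ^ 2) S₁ v.2 = y₂ at *
  generalize scaledAdjoint (t ^ 2) S₂ u.2 = z₁ at *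
  generalize scaledAdjoint (t ^ 2) S₂ v.2 = z₂ at *
  generalize ((u - α • Ψ.rhs (t ^ 2) S₁ S₂ u) - (v - α • Ψ.rhs (t ^ 2) S₁ S₂ v)) = d at *
  have hb := hΨ.lip_b u.1 v.1 y₂ y₂ z₂ z₂
  have hσ := hΨ.lip_σ u.1 v.1 y₂ y₂ z₂ z₂
  have hb' := hΨ.lip_b u.1 u.1 y₁ y₂ z₁ z₂
  have hσ' := hΨ.lip_σ u.1 u.1 y₁ y₂ z₁ z₂
  have hf := hΨ.lip_f v.1 v.1 y₁ y₂ z₁ z₂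
  have hΛ := hΨ.lip_Λ u.2 v.2
  simp only [sub_self, norm_zero, mul_zero, add_zero, zero_add] at hb hσ hf hb' hσ'
  have hmono := le_of_inner_identity hα hκ (D := ‖Ψ.f u.1 y₁ z₁ - Ψ.f v.1 y₁ z₁‖ ^ 2)
    (by linarith [hm.mono u.1 v.1 y₁ y₂ z₁ z₂, hm.mono_Λ u.2 v.2]) hneg
  have hL := ℓ.L_pos
  have hL1 := ℓ.L₁_pos
  have hL2 := ℓ.L₂_pos
  have hL3 := ℓ.L₃_pos
  have hL4 := ℓ.L₄_pos
  have hL5 := ℓ.L₅_pos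
  have hL6 := ℓ.L₆_pos
  have hx1 := norm_shift_le ht hS (u := Ψ.b u.1 y₁ z₁ - Ψ.b u.1 y₂ z₂)
    (v := Ψ.σ u.1 y₁ z₁ - Ψ.σ u.1 y₂ z₂)
    (B := (ℓ.L₃ + ℓ.L₄ + ℓ.L₅ + ℓ.L₆) * (‖y₁ - y₂‖ + ‖z₁ - z₂‖)) (by positivity) (by
      refine le_trans ?_ (pow_le_pow_left₀ (by positivity) ((add_le_add hb' hσ').trans ?_) 2)
      · linarith [mul_nonneg (norm_nonneg (Ψ.b u.1 y₁ z₁ - Ψ.b u.1 y₂ z₂))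
          (norm_nonneg (Ψ.σ u.1 y₁ z₁ - Ψ.σ u.1 y₂ z₂))]
      · have e1 : 0 ≤ ℓ.L₃ * ‖z₁ - z₂‖ := by positivity
        have e2 : 0 ≤ ℓ.L₄ * ‖y₁ - y₂‖ := by positivity
        have e3 : 0 ≤ ℓ.L₅ * ‖z₁ - z₂‖ := by positivity
        have e4 : 0 ≤ ℓ.L₆ * ‖y₁ - y₂‖ := by positivity
        linarith)
  have hx2 := norm_shift_le ht hS (u := Ψ.b u.1 y₂ z₂ - Ψ.b v.1 y₂ z₂)
    (v := Ψ.σ u.1 y₂ z₂ - Ψ.σ v.1 y₂ z₂) (B := 3 / 2 * (ℓ.L₁ * ‖u.1 - v.1‖)) (by positivity) (by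
      linarith [pow_le_pow_left₀ (norm_nonneg _) hb 2, pow_le_pow_left₀ (norm_nonneg _) hσ 2,
        sq_nonneg (ℓ.L₁ * ‖u.1 - v.1‖)])
  have hxle := (congrArg norm hp).trans_le (norm_add₄_le ..)
  have hyle := (congrArg norm hq).trans_le (norm_add₃_le ..)
  simp only [norm_neg, norm_smul, Real.norm_of_nonneg hα] at hxle hyle
  have hX := norm_nonneg (u.1 - v.1)
  have hY := norm_nonneg (u.2 - v.2)
  have hP := norm_nonneg d.1
  have hQ := norm_nonneg d.2
  refine backward_scalar_bound hα hα' hP hQ hX hY (by positivity) (by positivity)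
    (norm_nonneg _) (norm_nonneg _) (norm_nonneg _) (norm_nonneg _) ((add_le_add hx1 hΛ).trans ?_)
    (hx2.trans ?_) (hf.trans ?_) hxle hyle hmono
  · have : (ℓ.L₃ + ℓ.L₄ + ℓ.L₅ + ℓ.L₆) * (t * (‖y₁ - y₂‖ + ‖z₁ - z₂‖)) ≤
        (ℓ.L₃ + ℓ.L₄ + ℓ.L₅ + ℓ.L₆) * (3 / 2 * ‖u.2 - v.2‖) := by gcongr
    linarith
  · have := mul_le_mul_of_nonneg_right hL₁ hX
    linarith
  · have : 2 * ℓ.L₂ * (‖y₁ - y₂‖ + ‖z₁ - z₂‖) ≤ t * (‖y₁ - y₂‖ + ‖z₁ - z₂‖) := by gcongr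
    linarith

/-- A common constant for `forward_estimate` and `backward_estimate`. -/
noncomputable def stabilityConst (ℓ : LipschitzConstants) (κ : ℝ) : ℝ :=
  max (forwardConst ℓ κ) (backwardConst ℓ κ)

theorem stabilityConst_pos (ℓ : LipschitzConstants) (hκ : 0 < κ) : 0 < stabilityConst ℓ κ := by
  refine lt_max_of_lt_left ?_
  have := ℓ.L₁_pos
  have := ℓ.L₇_pos
  unfold forwardConst
  positivity

theorem stability_estimate (ht : 0 < t) (hL₁ : 2 * ℓ.L₁ * t ≤ 1) (hL₂ : 2 * ℓ.L₂ ≤ t) (hκ : 0 < κ)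
    (hS : ∀ u v, ‖S₁ u + S₂ v‖ ^ 2 = t ^ 2 * (‖u‖ ^ 2 + ‖v‖ ^ 2)) (hΨ : Ψ.IsLipschitz ℓ)
    (hm : Ψ.ForwardMonotone (t ^ 2) κ ∨ Ψ.BackwardMonotone (t ^ 2) κ) {α : ℝ} (hα : 0 ≤ α)
    (hα' : α ≤ 1) (u v : H × H) :
    ‖u.1 - v.1‖ + ‖u.2 - v.2‖ ≤ stabilityConst ℓ κ *
      (‖((u - α • Ψ.rhs (t ^ 2) S₁ S₂ u) - (v - α • Ψ.rhs (t ^ 2) S₁ S₂ v)).1‖ +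
        ‖((u - α • Ψ.rhs (t ^ 2) S₁ S₂ u) - (v - α • Ψ.rhs (t ^ 2) S₁ S₂ v)).2‖) := by
  rcases hm with hm | hm
  · refine (forward_estimate ht hL₁ hL₂ hκ hS hΨ hm hα hα' u v).trans ?_
    gcongr
    exact le_max_left _ _
  · refine (backward_estimate ht hL₁ hL₂ hκ hS hΨ hm hα hα' u v).trans ?_
    gcongr
    exact le_max_right _ _

theorem HilbertCoefficients.IsLipschitz.exists_rhs_lipschitz (hΨ : Ψ.IsLipschitz ℓ) (r : ℝ)
    (S₁ S₂ : H →L[ℝ] H) :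
    ∃ C, 0 < C ∧ ∀ u v, ‖Ψ.rhs r S₁ S₂ u - Ψ.rhs r S₁ S₂ v‖ ≤ C * ‖u - v‖ := by
  have hL := ℓ.L_pos
  have hL1 := ℓ.L₁_pos
  have hL2 := ℓ.L₂_pos
  have hL3 := ℓ.L₃_pos
  have hL4 := ℓ.L₄_pos
  have hL5 := ℓ.L₅_pos
  have hL6 := ℓ.L₆_pos
  have hL7 := ℓ.L₇_pos
  set D₁ := scaledAdjoint r S₁
  set D₂ := scaledAdjoint r S₂
  have h1 : ∀ u v : H × H, ‖D₁ u.2 - D₁ v.2‖ ≤ ‖D₁‖ * ‖u - v‖ := fun u v => by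
    rw [← map_sub]
    exact (D₁.le_opNorm _).trans (by gcongr; exact norm_snd_le (u - v))
  have h2 : ∀ u v : H × H, ‖D₂ u.2 - D₂ v.2‖ ≤ ‖D₂‖ * ‖u - v‖ := fun u v => by
    rw [← map_sub]
    exact (D₂.le_opNorm _).trans (by gcongr; exact norm_snd_le (u - v))
  have hx : ∀ u v : H × H, ‖u.1 - v.1‖ ≤ ‖u - v‖ := fun u v => norm_fst_le (u - v)
  have hy : ∀ u v : H × H, ‖u.2 - v.2‖ ≤ ‖u - v‖ := fun u v => norm_snd_le (u - v)
  let cb := ℓ.L₁ + ℓ.L₃ * ‖D₁‖ + ℓ.L₄ * ‖D₂‖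
  let cσ := ℓ.L₁ + ℓ.L₅ * ‖D₁‖ + ℓ.L₆ * ‖D₂‖
  let cf := ℓ.L₇ + ℓ.L₂ * (‖D₁‖ + ‖D₂‖)
  have hcb : 0 < cb := by positivity
  have hcσ : 0 < cσ := by positivity
  have hcf : 0 < cf := by positivity
  refine ⟨(‖S₁‖ * cb + ‖S₂‖ * cσ + ℓ.L) + cf, by positivity, fun u v => ?_⟩
  have hb : ‖Ψ.b u.1 (D₁ u.2) (D₂ u.2) - Ψ.b v.1 (D₁ v.2) (D₂ v.2)‖ ≤ cb * ‖u - v‖ := by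
    calc _ ≤ ℓ.L₁ * ‖u - v‖ + ℓ.L₃ * (‖D₁‖ * ‖u - v‖) + ℓ.L₄ * (‖D₂‖ * ‖u - v‖) := by
          refine (hΨ.lip_b _ _ _ _ _ _).trans ?_
          gcongr
          exacts [hx u v, h1 u v, h2 u v]
      _ = _ := by ring
  have hσ : ‖Ψ.σ u.1 (D₁ u.2) (D₂ u.2) - Ψ.σ v.1 (D₁ v.2) (D₂ v.2)‖ ≤ cσ * ‖u - v‖ := by
    calc _ ≤ ℓ.L₁ * ‖u - v‖ + ℓ.L₅ * (‖D₁‖ * ‖u - v‖) + ℓ.L₆ * (‖D₂‖ * ‖u - v‖) := by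
          refine (hΨ.lip_σ _ _ _ _ _ _).trans ?_
          gcongr
          exacts [hx u v, h1 u v, h2 u v]
      _ = _ := by ring
  have hf : ‖Ψ.f u.1 (D₁ u.2) (D₂ u.2) - Ψ.f v.1 (D₁ v.2) (D₂ v.2)‖ ≤ cf * ‖u - v‖ := by
    calc _ ≤ ℓ.L₇ * ‖u - v‖ + ℓ.L₂ * (‖D₁‖ * ‖u - v‖ + ‖D₂‖ * ‖u - v‖) := by
          refine (hΨ.lip_f _ _ _ _ _ _).trans ?_
          gcongr
          exacts [hx u v, h1 u v, h2 u v]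
      _ = _ := by ring
  have hΛ : ‖Ψ.Λ u.2 - Ψ.Λ v.2‖ ≤ ℓ.L * ‖u - v‖ :=
    (hΨ.lip_Λ _ _).trans (by gcongr; exact hy u v)
  have h0 := norm_nonneg (u - v)
  refine max_le ?_ ?_
  · have e : (Ψ.rhs r S₁ S₂ u - Ψ.rhs r S₁ S₂ v).1 =
        S₁ (Ψ.b u.1 (D₁ u.2) (D₂ u.2) - Ψ.b v.1 (D₁ v.2) (D₂ v.2))
        + S₂ (Ψ.σ u.1 (D₁ u.2) (D₂ u.2) - Ψ.σ v.1 (D₁ v.2) (D₂ v.2))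
        + (Ψ.Λ u.2 - Ψ.Λ v.2) := by
      simp only [HilbertCoefficients.rhs, Prod.fst_sub, map_sub]
      abel
    rw [e]
    calc _ ≤ ‖S₁‖ * (cb * ‖u - v‖) + ‖S₂‖ * (cσ * ‖u - v‖) + ℓ.L * ‖u - v‖ := by
          refine (norm_add₃_le ..).trans ?_
          gcongr
          · exact (S₁.le_opNorm _).trans (by gcongr)
          · exact (S₂.le_opNorm _).trans (by gcongr)
      _ = (‖S₁‖ * cb + ‖S₂‖ * cσ + ℓ.L) * ‖u - v‖ := by ring
      _ ≤ _ := mul_le_mul_of_nonneg_right (le_add_of_nonneg_right hcf.le) h0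
  · have e : (Ψ.rhs r S₁ S₂ u - Ψ.rhs r S₁ S₂ v).2 =
        -(Ψ.f u.1 (D₁ u.2) (D₂ u.2) - Ψ.f v.1 (D₁ v.2) (D₂ v.2)) := by
      simp only [HilbertCoefficients.rhs, Prod.snd_sub]
      abel
    rw [e, norm_neg]
    refine hf.trans ?_
    gcongr
    exact le_add_of_nonneg_left (by positivity)

theorem exists_eq_rhs (ht : 0 < t) (hL₁ : 2 * ℓ.L₁ * t ≤ 1) (hL₂ : 2 * ℓ.L₂ ≤ t) (hκ : 0 < κ)
    (hS : ∀ u v, ‖S₁ u + S₂ v‖ ^ 2 = t ^ 2 * (‖u‖ ^ 2 + ‖v‖ ^ 2)) (hΨ : Ψ.IsLipschitz ℓ)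
    (hm : Ψ.ForwardMonotone (t ^ 2) κ ∨ Ψ.BackwardMonotone (t ^ 2) κ) :
    ∃ u, u = Ψ.rhs (t ^ 2) S₁ S₂ u := by
  obtain ⟨C, hC, hlip⟩ := hΨ.exists_rhs_lipschitz (t ^ 2) S₁ S₂
  have hK := stabilityConst_pos ℓ hκ
  have hest : ∀ α : ℝ, 0 ≤ α → α ≤ 1 → ∀ u v : H × H, ‖u - v‖ ≤ stabilityConst ℓ κ * 2 *
      ‖(u - α • Ψ.rhs (t ^ 2) S₁ S₂ u) - (v - α • Ψ.rhs (t ^ 2) S₁ S₂ v)‖ := by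
    intro α hα hα' u v
    refine le_trans ?_ ((stability_estimate ht hL₁ hL₂ hκ hS hΨ hm hα hα' u v).trans ?_)
    · exact max_le (le_add_of_nonneg_right (norm_nonneg _)) (le_add_of_nonneg_left (norm_nonneg _))
    · rw [mul_assoc, two_mul]
      gcongr
      exacts [norm_fst_le _, norm_snd_le _]
  obtain ⟨u, hu⟩ := exists_sub_apply_eq_of_uniform_estimate (mul_pos hK two_pos) hC hlip hest 0
  exact ⟨u, sub_eq_zero.1 hu⟩

theorem norm_sub_le_of_eq_rhs (ht : 0 < t) (hL₁ : 2 * ℓ.L₁ * t ≤ 1) (hL₂ : 2 * ℓ.L₂ ≤ t)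
    (hκ : 0 < κ) (hS : ∀ u v, ‖S₁ u + S₂ v‖ ^ 2 = t ^ 2 * (‖u‖ ^ 2 + ‖v‖ ^ 2))
    (hΨ : Ψ.IsLipschitz ℓ) (hm : Ψ.ForwardMonotone (t ^ 2) κ ∨ Ψ.BackwardMonotone (t ^ 2) κ)
    {u : H × H} (hu : u = Ψ.rhs (t ^ 2) S₁ S₂ u) (v : H × H) :
    ‖u.1 - v.1‖ + ‖u.2 - v.2‖ ≤ stabilityConst ℓ κ *
      (‖(v - Ψ.rhs (t ^ 2) S₁ S₂ v).1‖ + ‖(v - Ψ.rhs (t ^ 2) S₁ S₂ v).2‖) := by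
  have h := stability_estimate ht hL₁ hL₂ hκ hS hΨ hm zero_le_one le_rfl u v
  rwa [one_smul, one_smul, ← hu, sub_self, zero_sub, Prod.fst_neg, Prod.snd_neg, norm_neg,
    norm_neg] at h

/-- The distance of a solution `u` to any `v`, when the residual of `v` is expressed through
differences `b`, `σ`, `Λ`, `f` of coefficients. -/
theorem norm_sq_sub_le_of_eq_rhs (ht : 0 < t) (hL₁ : 2 * ℓ.L₁ * t ≤ 1) (hL₂ : 2 * ℓ.L₂ ≤ t)
    (hκ : 0 < κ) (hS : ∀ u v, ‖S₁ u + S₂ v‖ ^ 2 = t ^ 2 * (‖u‖ ^ 2 + ‖v‖ ^ 2))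
    (hΨ : Ψ.IsLipschitz ℓ) (hm : Ψ.ForwardMonotone (t ^ 2) κ ∨ Ψ.BackwardMonotone (t ^ 2) κ)
    {u : H × H} (hu : u = Ψ.rhs (t ^ 2) S₁ S₂ u) {v : H × H} {b σ Λ f : H}
    (hv₁ : (Ψ.rhs (t ^ 2) S₁ S₂ v - v).1 = S₁ b + S₂ σ + Λ)
    (hv₂ : (Ψ.rhs (t ^ 2) S₁ S₂ v - v).2 = -f) :
    ‖u.1 - v.1‖ ^ 2 + ‖u.2 - v.2‖ ^ 2 ≤ 3 * stabilityConst ℓ κ ^ 2 *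
      (t ^ 2 * (‖b‖ ^ 2 + ‖σ‖ ^ 2) + ‖f‖ ^ 2 + ‖Λ‖ ^ 2) := by
  have h := norm_sub_le_of_eq_rhs ht hL₁ hL₂ hκ hS hΨ hm hu v
  rw [← norm_neg (v - _).1, ← norm_neg (v - _).2, ← Prod.fst_neg, ← Prod.snd_neg, neg_sub, hv₁, hv₂,
    norm_neg] at h
  have h' : ‖u.1 - v.1‖ + ‖u.2 - v.2‖ ≤ stabilityConst ℓ κ * (‖S₁ b + S₂ σ‖ + ‖Λ‖ + ‖f‖) := by
    refine h.trans ?_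
    have := (stabilityConst_pos ℓ hκ).le
    gcongr
    exact norm_add_le _ _
  rw [← hS]
  calc ‖u.1 - v.1‖ ^ 2 + ‖u.2 - v.2‖ ^ 2 ≤ (‖u.1 - v.1‖ + ‖u.2 - v.2‖) ^ 2 := by
        linarith [mul_nonneg (norm_nonneg (u.1 - v.1)) (norm_nonneg (u.2 - v.2))]
    _ ≤ (stabilityConst ℓ κ * (‖S₁ b + S₂ σ‖ + ‖Λ‖ + ‖f‖)) ^ 2 := by gcongr
    _ = stabilityConst ℓ κ ^ 2 * (‖S₁ b + S₂ σ‖ + ‖Λ‖ + ‖f‖) ^ 2 := by ring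
    _ ≤ stabilityConst ℓ κ ^ 2 * (3 * (‖S₁ b + S₂ σ‖ ^ 2 + ‖f‖ ^ 2 + ‖Λ‖ ^ 2)) := by
        gcongr
        linarith [sq_nonneg (‖S₁ b + S₂ σ‖ - ‖Λ‖), sq_nonneg (‖S₁ b + S₂ σ‖ - ‖f‖),
          sq_nonneg (‖Λ‖ - ‖f‖)]
    _ = _ := by ring

end HilbertSpace

/-! ### Superposition operators on spaces of square-integrable functions -/

section Superposition

open Filter Topology

theorem stronglyMeasurable_comp_simpleFunc {X Θ F : Type*} {m : MeasurableSpace X}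
    [NormedAddCommGroup F] [SecondCountableTopology F] {φ : X → Θ → F}
    (hφ : ∀ θ, StronglyMeasurable fun p => φ p θ) (s : SimpleFunc X Θ) :
    StronglyMeasurable fun p => φ p (s p) := by
  borelize F
  refine stronglyMeasurable_iff_measurable.2 fun B hB => ?_
  have : (fun p => φ p (s p)) ⁻¹' B =
      ⋃ θ ∈ s.range, s ⁻¹' {θ} ∩ (fun p => φ p θ) ⁻¹' B := by
    ext p
    simp only [Set.mem_preimage, Set.mem_iUnion, Set.mem_inter_iff, Set.mem_singleton_iff]
    exact ⟨fun h => ⟨s p, s.mem_range_self p, rfl, h⟩, fun ⟨_, _, h, h'⟩ => by rwa [h]⟩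
  rw [this]
  exact Finset.measurableSet_biUnion _ fun θ _ =>
    (s.measurableSet_fiber θ).inter ((hφ θ).measurable hB)

variable {X : Type*} {m m₀ : MeasurableSpace X} {μ : Measure X}

/-- Composition with a random field that is almost surely continuous preserves measurability with
respect to the sub-sigma-algebra `m`. The exceptional null set need not be contained in an
`m`-measurable null set, so the composition is only almost everywhere equal to an `m`-measurable
function. -/
theorem aestronglyMeasurable_comp_of_ae_continuous {Θ F : Type*}
    [NormedAddCommGroup Θ] [SecondCountableTopology Θ]
    [NormedAddCommGroup F] [CompleteSpace F] [SecondCountableTopology F]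
    {φ : X → Θ → F} (hφ : ∀ θ, StronglyMeasurable[m] fun p => φ p θ)
    (hc : ∀ᵐ p ∂μ, Continuous (φ p)) {u : X → Θ} (hu : AEStronglyMeasurable[m] u μ) :
    AEStronglyMeasurable[m] (fun p => φ p (u p)) μ := by
  obtain ⟨v, hv, huv⟩ := hu
  let s : ℕ → @SimpleFunc X m Θ := hv.approx
  have hs : ∀ j, StronglyMeasurable[m] fun p => φ p (s j p) :=
    fun j => stronglyMeasurable_comp_simpleFunc hφ (s j)
  -- `limUnder` is measurable on all of `X`, also where the sequence does not converge.
  refine ⟨fun p => limUnder atTop fun j => φ p (s j p),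
    @StronglyMeasurable.limUnder ℕ X F m _ _ atTop _ _ _ _ hs, ?_⟩
  filter_upwards [hc, huv] with p hp hup
  rw [hup]
  exact ((hp.tendsto _).comp (hv.tendsto_approx p)).limUnder_eq.symm

variable {E : Type*} [NormedAddCommGroup E]

variable (m μ) in
/-- A random field `φ p x y z` that is `m`-measurable in `p`, almost surely Lipschitz in `(x, y, z)`, and
square-integrable at the origin. -/
structure IsLipschitzField (C : ℝ) (φ : X → E → E → E → E) : Prop where
  meas : ∀ x y z, StronglyMeasurable[m] fun p => φ p x y z
  lip : ∀ᵐ p ∂μ, ∀ x₁ x₂ y₁ y₂ z₁ z₂, ‖φ p x₁ y₁ z₁ - φ p x₂ y₂ z₂‖ ≤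
    C * (‖x₁ - x₂‖ + ‖y₁ - y₂‖ + ‖z₁ - z₂‖)
  memLp : MemLp (fun p => φ p 0 0 0) 2 μ

namespace IsLipschitzField

variable [CompleteSpace E] [SecondCountableTopology E] {C : ℝ} {φ : X → E → E → E → E}

theorem aestronglyMeasurable_comp (h : IsLipschitzField m μ C φ) {x y z : X → E}
    (hx : AEStronglyMeasurable[m] x μ) (hy : AEStronglyMeasurable[m] y μ)
    (hz : AEStronglyMeasurable[m] z μ) :
    AEStronglyMeasurable[m] (fun p => φ p (x p) (y p) (z p)) μ := by
  refine aestronglyMeasurable_comp_of_ae_continuous (Θ := E × E × E)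
    (φ := fun p θ => φ p θ.1 θ.2.1 θ.2.2) (fun θ => h.meas _ _ _) ?_ (u := fun p => (x p, y p, z p))
    (hx.prodMk (hy.prodMk hz))
  filter_upwards [h.lip] with p hp
  refine (LipschitzWith.of_dist_le_mul (K := (C * 3).toNNReal) fun θ η => ?_).continuous
  rw [dist_eq_norm, dist_eq_norm]
  have h1 := norm_fst_le (θ - η)
  have h2 := (norm_fst_le (θ - η).2).trans (norm_snd_le (θ - η))
  have h3 := (norm_snd_le (θ - η).2).trans (norm_snd_le (θ - η))
  refine (hp _ _ _ _ _ _).trans ?_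
  have hle : ‖θ.1 - η.1‖ + ‖θ.2.1 - η.2.1‖ + ‖θ.2.2 - η.2.2‖ ≤ 3 * ‖θ - η‖ := by
    simp only [Prod.fst_sub, Prod.snd_sub] at h1 h2 h3
    linarith
  calc _ ≤ (C.toNNReal : ℝ) * (‖θ.1 - η.1‖ + ‖θ.2.1 - η.2.1‖ + ‖θ.2.2 - η.2.2‖) := by
        gcongr; exact Real.le_coe_toNNReal C
    _ ≤ (C.toNNReal : ℝ) * (3 * ‖θ - η‖) := by gcongr
    _ = _ := by
      rw [mul_comm C, Real.toNNReal_mul (by norm_num), NNReal.coe_mul,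
        Real.coe_toNNReal 3 (by norm_num)]
      ring

theorem memLp_comp (hm : m ≤ m₀) (h : IsLipschitzField m μ C φ) {x y z : X → E}
    (hx : AEStronglyMeasurable[m] x μ) (hy : AEStronglyMeasurable[m] y μ)
    (hz : AEStronglyMeasurable[m] z μ) (hx' : MemLp x 2 μ) (hy' : MemLp y 2 μ)
    (hz' : MemLp z 2 μ) : MemLp (fun p => φ p (x p) (y p) (z p)) 2 μ := by
  have hd : MemLp (fun p => φ p (x p) (y p) (z p) - φ p 0 0 0) 2 μ := by
    refine MemLp.of_le_mul (g := fun p => ‖x p‖ + ‖y p‖ + ‖z p‖) (c := C)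
      ((hx'.norm.add hy'.norm).add hz'.norm)
      (((h.aestronglyMeasurable_comp hx hy hz).mono hm).sub h.memLp.aestronglyMeasurable) ?_
    filter_upwards [h.lip] with p hp
    refine (hp _ _ _ _ _ _).trans_eq ?_
    rw [Real.norm_of_nonneg (by positivity), sub_zero, sub_zero, sub_zero]
  refine (memLp_congr_ae (.of_forall fun p => ?_)).1 (hd.add h.memLp)
  exact sub_add_cancel _ _

end IsLipschitzField

variable [InnerProductSpace ℝ E]

/-- Elements of `lpMeas` are evaluated at points through their representatives in `Lp`. -/
noncomputable instance : CoeFun (lpMeas E ℝ m 2 μ) fun _ => X → E :=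
  ⟨fun u => ((u : Lp E 2 μ) : X → E)⟩

theorem lpMeas_norm_le_of_ae_le {d u v w : lpMeas E ℝ m 2 μ} {a b c : ℝ} 
    (h : ∀ᵐ p ∂μ, ‖d p‖ ≤ a * ‖u p‖ + b * ‖v p‖ + c * ‖w p‖) (ha : 0 ≤ a) (hb : 0 ≤ b)
    (hc : 0 ≤ c) : ‖d‖ ≤ a * ‖u‖ + b * ‖v‖ + c * ‖w‖ := by
  have key : ∀ f : lpMeas E ℝ m 2 μ, ∃ g : Lp ℝ 2 μ, ‖g‖ = ‖f‖ ∧ ∀ᵐ p ∂μ, g p = ‖f p‖ := by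
    intro f
    have hf := (Lp.memLp (f : Lp E 2 μ)).norm
    refine ⟨hf.toLp _, ?_, hf.coeFn_toLp⟩
    rw [Lp.norm_toLp, eLpNorm_norm]
    rfl
  obtain ⟨U, hU, hU'⟩ := key u
  obtain ⟨V, hV, hV'⟩ := key v
  obtain ⟨W, hW, hW'⟩ := key w
  have h1 : ‖(d : Lp E 2 μ)‖ ≤ ‖a • U + b • V + c • W‖ := by
    refine Lp.norm_le_norm_of_ae_le ?_
    filter_upwards [h, hU', hV', hW', Lp.coeFn_add (a • U + b • V) (c • W),
      Lp.coeFn_add (a • U) (b • V), Lp.coeFn_smul a U, Lp.coeFn_smul b V,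
      Lp.coeFn_smul c W] with p hp e1 e2 e3 e4 e5 e6 e7 e8
    rw [e4, Pi.add_apply, e5, Pi.add_apply, e6, e7, e8]
    simp only [Pi.smul_apply, e1, e2, e3, smul_eq_mul]
    exact hp.trans (le_abs_self _)
  calc ‖d‖ ≤ ‖a • U + b • V + c • W‖ := h1
    _ ≤ ‖a • U‖ + ‖b • V‖ + ‖c • W‖ := norm_add₃_le ..
    _ = _ := by
      rw [norm_smul, norm_smul, norm_smul, hU, hV, hW, Real.norm_of_nonneg ha,
        Real.norm_of_nonneg hb, Real.norm_of_nonneg hc]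

theorem lpMeas_inner_eq (u v : lpMeas E ℝ m 2 μ) :
    inner ℝ u v = ∫ p, inner ℝ (u p) (v p) ∂μ := by
  rw [Submodule.coe_inner, L2.inner_def]

theorem lpMeas_integrable_inner (u v : lpMeas E ℝ m 2 μ) :
    Integrable (fun p => inner ℝ (u p) (v p)) μ :=
  L2.integrable_inner (𝕜 := ℝ) (u : Lp E 2 μ) v

theorem lpMeas_enorm_sq (u : lpMeas E ℝ m 2 μ) : ‖u‖ₑ ^ 2 = ∫⁻ p, ‖u p‖ₑ ^ 2 ∂μ := by
  have h := eLpNorm_nnreal_pow_eq_lintegral (f := (u : X → E)) (μ := μ) (p := 2) two_ne_zero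
  have e : ‖u‖ₑ = eLpNorm u 2 μ := Lp.enorm_def (u : Lp E 2 μ)
  rw [e]
  simpa using h

theorem lpMeas_ext {u v : lpMeas E ℝ m 2 μ} (h : (u : X → E) =ᵐ[μ] v) : u = v :=
  Subtype.ext (Lp.ext h)

theorem lpMeas_coeFn_sub (u v : lpMeas E ℝ m 2 μ) :
    ((u - v : lpMeas E ℝ m 2 μ) : X → E) =ᵐ[μ] fun p => u p - v p :=
  Lp.coeFn_sub (u : Lp E 2 μ) v

theorem lpMeas_coeFn_add (u v : lpMeas E ℝ m 2 μ) :
    ((u + v : lpMeas E ℝ m 2 μ) : X → E) =ᵐ[μ] fun p => u p + v p :=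
  Lp.coeFn_add (u : Lp E 2 μ) v

theorem lpMeas_coeFn_neg (u : lpMeas E ℝ m 2 μ) :
    ((-u : lpMeas E ℝ m 2 μ) : X → E) =ᵐ[μ] fun p => -u p :=
  Lp.coeFn_neg (u : Lp E 2 μ)

theorem lpMeas_coeFn_zero : ((0 : lpMeas E ℝ m 2 μ) : X → E) =ᵐ[μ] fun _ => 0 :=
  Lp.coeFn_zero E 2 μ

theorem lpMeas_coeFn_smul (c : ℝ) (u : lpMeas E ℝ m 2 μ) :
    ((c • u : lpMeas E ℝ m 2 μ) : X → E) =ᵐ[μ] fun p => c • u p :=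
  Lp.coeFn_smul c (u : Lp E 2 μ)

namespace IsLipschitzField

variable [CompleteSpace E] [SecondCountableTopology E] {C : ℝ} {φ : X → E → E → E → E}

/-- The superposition operator `(x, y, z) ↦ φ(·, x, y, z)` of a random field on `L²`. -/
noncomputable def superposition (hm : m ≤ m₀) (h : IsLipschitzField m μ C φ)
    (x y z : lpMeas E ℝ m 2 μ) : lpMeas E ℝ m 2 μ :=
  ⟨(h.memLp_comp hm (lpMeas.aestronglyMeasurable x) (lpMeas.aestronglyMeasurable y)
      (lpMeas.aestronglyMeasurable z) (Lp.memLp _) (Lp.memLp _) (Lp.memLp _)).toLp _,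
    mem_lpMeas_iff_aestronglyMeasurable.2
      ((h.aestronglyMeasurable_comp (lpMeas.aestronglyMeasurable x)
        (lpMeas.aestronglyMeasurable y) (lpMeas.aestronglyMeasurable z)).congr
          (MemLp.coeFn_toLp _).symm)⟩

theorem coeFn_superposition (hm : m ≤ m₀) (h : IsLipschitzField m μ C φ)
    (x y z : lpMeas E ℝ m 2 μ) :
    (h.superposition hm x y z : X → E) =ᵐ[μ] fun p => φ p (x p) (y p) (z p) :=
  (h.memLp_comp hm (lpMeas.aestronglyMeasurable x) (lpMeas.aestronglyMeasurable y)
    (lpMeas.aestronglyMeasurable z) (Lp.memLp _) (Lp.memLp _) (Lp.memLp _)).coeFn_toLp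

end IsLipschitzField

end Superposition

/-! ### The Hilbert space of adapted processes -/

section Stage

variable {Ω : Type*} {mΩ : MeasurableSpace Ω} {n : ℕ}

/-- The sigma-algebra on `ℕ × Ω` of the sets whose section at time `k` belongs to `ℱ k`. A process is
adapted to `ℱ` if and only if it is measurable for it. -/
abbrev stageSpace (ℱ : Filtration ℕ mΩ) : MeasurableSpace (ℕ × Ω) :=
  ⨅ k, (ℱ k).map (Prod.mk k)

theorem measurableSet_stageSpace_iff {ℱ : Filtration ℕ mΩ} {s : Set (ℕ × Ω)} :
    MeasurableSet[stageSpace ℱ] s ↔ ∀ k, MeasurableSet[ℱ k] (Prod.mk k ⁻¹' s) :=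
  MeasurableSpace.measurableSet_iInf

theorem stageSpace_le (ℱ : Filtration ℕ mΩ) : stageSpace ℱ ≤ Prod.instMeasurableSpace := by
  intro s hs
  rw [measurableSet_stageSpace_iff] at hs
  have : s = ⋃ k, Prod.mk k '' (Prod.mk k ⁻¹' s) := by
    ext ⟨k, ω⟩
    simp
  rw [this]
  exact MeasurableSet.iUnion fun k =>
    (measurableEmbedding_prodMk_left k).measurableSet_image.2 (ℱ.le k _ (hs k))

instance (ℱ : Filtration ℕ mΩ) : Fact (stageSpace ℱ ≤ Prod.instMeasurableSpace) :=
  ⟨stageSpace_le ℱ⟩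

theorem stronglyMeasurable_stageSpace_iff {ℱ : Filtration ℕ mΩ} {g : ℕ × Ω → Vec n} :
    StronglyMeasurable[stageSpace ℱ] g ↔ ∀ k, StronglyMeasurable[ℱ k] fun ω => g (k, ω) := by
  simp only [stronglyMeasurable_iff_measurable]
  refine ⟨fun h k B hB => measurableSet_stageSpace_iff.1 (h hB) k, fun h B hB =>
    measurableSet_stageSpace_iff.2 fun k => h k hB⟩

/-- The measure `∑ₖ e^{-ρ k} δₖ ⊗ P` on `ℕ × Ω`. The weighted norm of a process is its `L²` norm. -/
noncomputable def stageMeasure (P : Measure Ω) (ρ : ℝ) : Measure (ℕ × Ω) :=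
  Measure.sum fun k : ℕ => ENNReal.ofReal (Real.exp (-ρ * k)) • P.map (Prod.mk k)

variable {P : Measure Ω} {ρ : ℝ}

theorem lintegral_stageMeasure (F : ℕ × Ω → ℝ≥0∞) :
    ∫⁻ p, F p ∂stageMeasure P ρ =
      ∑' k : ℕ, ENNReal.ofReal (Real.exp (-ρ * k)) * ∫⁻ ω, F (k, ω) ∂P := by
  rw [stageMeasure, lintegral_sum_measure]
  refine tsum_congr fun k => ?_
  rw [lintegral_smul_measure, (measurableEmbedding_prodMk_left k).lintegral_map, smul_eq_mul]

theorem integral_stageMeasure {F : ℕ × Ω → ℝ} (hF : Integrable F (stageMeasure P ρ)) :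
    ∫ p, F p ∂stageMeasure P ρ = ∑' k : ℕ, Real.exp (-ρ * k) * ∫ ω, F (k, ω) ∂P := by
  rw [stageMeasure, integral_sum_measure hF]
  refine tsum_congr fun k => ?_
  rw [integral_smul_measure, (measurableEmbedding_prodMk_left k).integral_map, smul_eq_mul,
    ENNReal.toReal_ofReal (Real.exp_nonneg _)]

theorem ae_stageMeasure_iff {φ : ℕ × Ω → Prop} :
    (∀ᵐ p ∂stageMeasure P ρ, φ p) ↔ ∀ k, ∀ᵐ ω ∂P, φ (k, ω) := by
  rw [stageMeasure, Measure.ae_sum_iff]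
  refine forall_congr' fun k => ?_
  rw [Measure.ae_ennreal_smul_measure_iff (ENNReal.ofReal_pos.2 (Real.exp_pos _)).ne',
    (measurableEmbedding_prodMk_left k).ae_map_iff]

theorem ae_stageMeasure_of_forall {φ : ℕ → Ω → Prop} (h : ∀ k, ∀ᵐ ω ∂P, φ k ω) :
    ∀ᵐ p ∂stageMeasure P ρ, φ p.1 p.2 :=
  ae_stageMeasure_iff.2 h

theorem memLp_stageMeasure_section {g : ℕ × Ω → Vec n} (hg : MemLp g 2 (stageMeasure P ρ)) (k : ℕ) :
    MemLp (fun ω => g (k, ω)) 2 P := by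
  have h1 : MemLp g 2 (ENNReal.ofReal (Real.exp (-ρ * k)) • P.map (Prod.mk k)) :=
    hg.mono_measure (Measure.le_sum _ k)
  have h2 : MemLp g 2 (P.map (Prod.mk k)) := by
    refine h1.of_measure_le_smul (c := (ENNReal.ofReal (Real.exp (-ρ * k)))⁻¹)
      (ENNReal.inv_ne_top.2 (ENNReal.ofReal_pos.2 (Real.exp_pos _)).ne') ?_
    rw [smul_smul, ENNReal.inv_mul_cancel (ENNReal.ofReal_pos.2 (Real.exp_pos _)).ne'  ENNReal.ofReal_ne_top,
      one_smul]
  exact (measurableEmbedding_prodMk_left k).memLp_map_measure_iff.1 h2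

theorem sqNorm_eq_lintegral {g : ℕ → Ω → Vec n} (hg : ∀ k, AEStronglyMeasurable (g k) P) :
    sqNorm P ρ g = ∫⁻ p, ‖g p.1 p.2‖ₑ ^ 2 ∂stageMeasure P ρ := by
  rw [lintegral_stageMeasure, sqNorm, lintegral_tsum]
  · refine tsum_congr fun k => ?_
    rw [lintegral_const_mul' _ _ ENNReal.ofReal_ne_top]
  · exact fun k => ((hg k).enorm.pow_const 2).const_mul _

theorem memLp_two_of_lintegral_lt_top {X : Type*} {m₀ : MeasurableSpace X} {μ : Measure X}
    {g : X → Vec n} (hg : AEStronglyMeasurable g μ) (h : ∫⁻ p, ‖g p‖ₑ ^ 2 ∂μ < ∞) :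
    MemLp g 2 μ := by
  refine ⟨hg, (eLpNorm_lt_top_iff_lintegral_rpow_enorm_lt_top two_ne_zero ENNReal.ofNat_ne_top).2 ?_⟩
  simpa using h

theorem MemL2.memLp {ℱ : Filtration ℕ mΩ} {g : ℕ → Ω → Vec n} (hg : MemL2 P ℱ ρ g) :
    MemLp (fun p : ℕ × Ω => g p.1 p.2) 2 (stageMeasure P ρ) := by
  refine memLp_two_of_lintegral_lt_top (((stronglyMeasurable_stageSpace_iff (ℱ := ℱ)
    (g := fun p : ℕ × Ω => g p.1 p.2)).2 hg.1).mono (stageSpace_le ℱ)).aestronglyMeasurable ?_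
  rw [← sqNorm_eq_lintegral fun k => ((hg.1 k).mono (ℱ.le k)).aestronglyMeasurable]
  exact hg.2

variable (P ρ) in
/-- The weighted space `L^{2,ρ}` as a Hilbert space: the classes in `L²(ℕ × Ω)` that have an adapted
representative. -/
abbrev StageL2 (ℱ : Filtration ℕ mΩ) (n : ℕ) : Type _ :=
  lpMeas (Vec n) ℝ (stageSpace ℱ) 2 (stageMeasure P ρ)

variable {ℱ : Filtration ℕ mΩ}

/-- The class of a process in the weighted space. -/
noncomputable def MemL2.toStageL2 {g : ℕ → Ω → Vec n} (hg : MemL2 P ℱ ρ g) : StageL2 P ρ ℱ n :=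
  ⟨hg.memLp.toLp _, mem_lpMeas_iff_aestronglyMeasurable.2
    (((stronglyMeasurable_stageSpace_iff (g := fun p : ℕ × Ω => g p.1 p.2)).2
      hg.1).aestronglyMeasurable.congr hg.memLp.coeFn_toLp.symm)⟩

theorem MemL2.coeFn_toStageL2 {g : ℕ → Ω → Vec n} (hg : MemL2 P ℱ ρ g) :
    ∀ k, ∀ᵐ ω ∂P, hg.toStageL2 (k, ω) = g k ω :=
  ae_stageMeasure_iff.1 hg.memLp.coeFn_toLp

theorem sqNorm_eq_enorm_sq {g : ℕ → Ω → Vec n} {u : StageL2 P ρ ℱ n}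
    (h : ∀ k, ∀ᵐ ω ∂P, u (k, ω) = g k ω) : sqNorm P ρ g = ‖u‖ₑ ^ 2 := by
  have hu := Lp.memLp (u : Lp (Vec n) 2 (stageMeasure P ρ))
  have hg : ∀ k, AEStronglyMeasurable (g k) P := fun k =>
    (memLp_stageMeasure_section hu k).aestronglyMeasurable.congr (h k)
  rw [sqNorm_eq_lintegral hg, lpMeas_enorm_sq]
  refine lintegral_congr_ae ?_
  filter_upwards [ae_stageMeasure_iff (φ := fun p => u p = g p.1 p.2).2 h] with p hp
  rw [hp]

theorem StageL2.exists_process (u : StageL2 P ρ ℱ n) :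
    ∃ g : ℕ → Ω → Vec n, MemL2 P ℱ ρ g ∧ ∀ k, ∀ᵐ ω ∂P, u (k, ω) = g k ω := by
  obtain ⟨g, hg, hug⟩ := lpMeas.aestronglyMeasurable u
  have h : ∀ k, ∀ᵐ ω ∂P, u (k, ω) = g (k, ω) := ae_stageMeasure_iff.1 hug
  refine ⟨fun k ω => g (k, ω), ⟨stronglyMeasurable_stageSpace_iff.1 hg, ?_⟩, h⟩
  rw [sqNorm_eq_enorm_sq (u := u) h]
  exact ENNReal.pow_lt_top enorm_lt_top

end Stage

/-! ### Shift operators and conditional expectations -/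

section Shift

theorem MemLp.integrable_inner_of_two {α E : Type*} {m : MeasurableSpace α} {μ : Measure α}
    [NormedAddCommGroup E] [InnerProductSpace ℝ E] {f g : α → E} (hf : MemLp f 2 μ)
    (hg : MemLp g 2 μ) : Integrable (fun a => inner ℝ (f a) (g a)) μ := by
  refine (L2.integrable_inner (𝕜 := ℝ) (hf.toLp f) (hg.toLp g)).congr ?_
  filter_upwards [hf.coeFn_toLp, hg.coeFn_toLp] with a h1 h2
  rw [h1, h2]

theorem StronglyMeasurable.measurable_enorm_sq {α E : Type*} {m : MeasurableSpace α}
    [NormedAddCommGroup E] {f : α → E} (hf : StronglyMeasurable f) :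
    Measurable fun a => ‖f a‖ₑ ^ 2 :=
  hf.enorm.pow_const 2

variable {Ω : Type*} {mΩ : MeasurableSpace Ω} {n : ℕ} {P : Measure Ω} {ρ : ℝ}
  {ℱ : Filtration ℕ mΩ} {c : ℕ → Ω → ℝ}

variable (P ℱ) in
/-- A sequence of multipliers `c k`, measurable with respect to `ℱ (k + 1)`, with conditional second
moment `1` given `ℱ k`. The two instances of interest are the constant `1` and the noise. -/
structure IsUnitMultiplier (c : ℕ → Ω → ℝ) : Prop where
  adapted : ∀ k, StronglyMeasurable[ℱ (k + 1)] (c k)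
  setLIntegral : ∀ k A, MeasurableSet[ℱ k] A → ∫⁻ ω in A, ‖c k ω‖ₑ ^ 2 ∂P = P A

theorem isUnitMultiplier_one : IsUnitMultiplier P ℱ fun _ _ => 1 where
  adapted _ := stronglyMeasurable_const
  setLIntegral k A _ := by simp

theorem IsNoise.isUnitMultiplier [IsProbabilityMeasure P] {w : ℕ → Ω → ℝ} (hw : IsNoise P ℱ w) :
    IsUnitMultiplier P ℱ w where
  adapted := hw.adapted
  setLIntegral k A hA := by
    have h1 : Integrable (fun ω => w k ω ^ 2) P := (hw.memLp k).integrable_sq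
    have h2 : ∫ ω in A, w k ω ^ 2 ∂P = P.real A := by
      rw [← setIntegral_condExp (ℱ.le k) h1 hA,
        setIntegral_congr_ae (g := fun _ => (1 : ℝ)) (ℱ.le k _ hA)
          ((hw.unit_variance k).mono fun ω h _ => h)]
      simp
    rw [← ofReal_measureReal, ← h2, ofReal_integral_eq_lintegral_ofReal h1.integrableOn
      (.of_forall fun ω => sq_nonneg _)]
    refine lintegral_congr fun ω => ?_
    rw [← ofReal_norm, ← ENNReal.ofReal_pow (norm_nonneg _), Real.norm_eq_abs, sq_abs]

/-- The defining identity, extended from sets in `ℱ k` to nonnegative functions: the measures `P` and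
`|c k|² P` agree on `ℱ k`. -/
theorem IsUnitMultiplier.lintegral_mul (hc : IsUnitMultiplier P ℱ c) (k : ℕ) {F : Ω → ℝ≥0∞}
    (hF : Measurable[ℱ k] F) : ∫⁻ ω, ‖c k ω‖ₑ ^ 2 * F ω ∂P = ∫⁻ ω, F ω ∂P := by
  have hcm : Measurable fun ω => ‖c k ω‖ₑ ^ 2 :=
    ((hc.adapted k).mono (ℱ.le _)).enorm.pow_const 2
  have htrim : (P.withDensity fun ω => ‖c k ω‖ₑ ^ 2).trim (ℱ.le k) = P.trim (ℱ.le k) := by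
    refine @Measure.ext _ (ℱ k) _ _ fun A hA => ?_
    rw [trim_measurableSet_eq _ hA, trim_measurableSet_eq _ hA, withDensity_apply _ (ℱ.le k _ hA),
      hc.setLIntegral k A hA]
  have h := lintegral_withDensity_eq_lintegral_mul P hcm (hF.mono (ℱ.le k) le_rfl)
  simp only [Pi.mul_apply] at h
  rw [← h, ← lintegral_trim (ℱ.le k) hF, htrim, lintegral_trim (ℱ.le k) hF]

/-- The process that vanishes at time `0` and equals `c k • u k` at time `k + 1`. -/
def shiftMul (c : ℕ → Ω → ℝ) (u : ℕ × Ω → Vec n) : ℕ × Ω → Vec n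
  | (0, _) => 0
  | (k + 1, ω) => c k ω • u (k, ω)

theorem shiftMul_congr_ae {u v : ℕ × Ω → Vec n} (h : u =ᵐ[stageMeasure P ρ] v) :
    shiftMul c u =ᵐ[stageMeasure P ρ] shiftMul c v := by
  refine ae_stageMeasure_iff.2 fun k => ?_
  cases k with
  | zero => exact .of_forall fun ω => rfl
  | succ k =>
    filter_upwards [ae_stageMeasure_iff.1 h k] with ω hω
    simp only [shiftMul, hω]

theorem IsUnitMultiplier.stronglyMeasurable_shiftMul (hc : IsUnitMultiplier P ℱ c)
    {u : ℕ × Ω → Vec n} (hu : StronglyMeasurable[stageSpace ℱ] u) :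
    StronglyMeasurable[stageSpace ℱ] (shiftMul c u) := by
  rw [stronglyMeasurable_stageSpace_iff] at hu ⊢
  intro k
  cases k with
  | zero => exact stronglyMeasurable_const
  | succ k => exact (hc.adapted k).smul ((hu k).mono (ℱ.mono k.le_succ))

theorem IsUnitMultiplier.lintegral_shiftMul (hc : IsUnitMultiplier P ℱ c)
    {u : ℕ × Ω → Vec n} (hu : StronglyMeasurable[stageSpace ℱ] u) :
    ∫⁻ p, ‖shiftMul c u p‖ₑ ^ 2 ∂stageMeasure P ρ =
      ENNReal.ofReal (Real.exp (-ρ)) * ∫⁻ p, ‖u p‖ₑ ^ 2 ∂stageMeasure P ρ := by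
  rw [lintegral_stageMeasure, lintegral_stageMeasure, tsum_eq_zero_add' ENNReal.summable,
    ← ENNReal.tsum_mul_left]
  simp only [shiftMul, enorm_zero, ne_eq, OfNat.ofNat_ne_zero, not_false_eq_true, zero_pow,
    lintegral_const, zero_mul, mul_zero, zero_add]
  refine tsum_congr fun k => ?_
  rw [← mul_assoc, ← ENNReal.ofReal_mul (Real.exp_nonneg _), ← Real.exp_add]
  congr 1
  · congr 2
    push_cast
    ring
  · simp only [enorm_smul, mul_pow]
    exact hc.lintegral_mul k
      (StronglyMeasurable.measurable_enorm_sq (stronglyMeasurable_stageSpace_iff.1 hu k))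

theorem IsUnitMultiplier.exists_shift (hc : IsUnitMultiplier P ℱ c) (u : StageL2 P ρ ℱ n) :
    ∃ v : StageL2 P ρ ℱ n, (v : ℕ × Ω → Vec n) =ᵐ[stageMeasure P ρ] shiftMul c u := by
  obtain ⟨g, hg, hug⟩ := lpMeas.aestronglyMeasurable u
  have hs := hc.stronglyMeasurable_shiftMul hg
  have hL : MemLp (shiftMul c g) 2 (stageMeasure P ρ) := by
    refine memLp_two_of_lintegral_lt_top (hs.mono (stageSpace_le ℱ)).aestronglyMeasurable ?_
    rw [hc.lintegral_shiftMul hg]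
    refine ENNReal.mul_lt_top ENNReal.ofReal_lt_top ?_
    rw [lintegral_congr_ae (g := fun p => ‖u p‖ₑ ^ 2) (hug.mono fun p hp => by
      simp only [hp]), ← lpMeas_enorm_sq]
    exact ENNReal.pow_lt_top enorm_lt_top
  refine ⟨⟨hL.toLp _, mem_lpMeas_iff_aestronglyMeasurable.2
    (hs.aestronglyMeasurable.congr hL.coeFn_toLp.symm)⟩, ?_⟩
  exact hL.coeFn_toLp.trans (shiftMul_congr_ae hug.symm)

theorem norm_sq_shift (hc : IsUnitMultiplier P ℱ c) {u v : StageL2 P ρ ℱ n}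
    (h : (v : ℕ × Ω → Vec n) =ᵐ[stageMeasure P ρ] shiftMul c u) :
    ‖v‖ ^ 2 = Real.exp (-ρ) * ‖u‖ ^ 2 := by
  obtain ⟨g, hg, hug⟩ := lpMeas.aestronglyMeasurable u
  have e : ‖v‖ₑ ^ 2 = ENNReal.ofReal (Real.exp (-ρ)) * ‖u‖ₑ ^ 2 := by
    rw [lpMeas_enorm_sq u, lintegral_congr_ae (g := fun p => ‖g p‖ₑ ^ 2)
      (hug.mono fun p hp => by simp only [hp]), ← hc.lintegral_shiftMul hg, lpMeas_enorm_sq]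
    refine lintegral_congr_ae ?_
    filter_upwards [h.trans (shiftMul_congr_ae hug)] with p hp
    rw [hp]
  have := congrArg ENNReal.toReal e
  simpa [ENNReal.toReal_mul, ENNReal.toReal_ofReal (Real.exp_nonneg _)] using this

/-- The operator `shiftMul c` on the weighted space; it multiplies norms by `e^{-ρ/2}`. -/
noncomputable def IsUnitMultiplier.shift (hc : IsUnitMultiplier P ℱ c) (ρ : ℝ) (n : ℕ) :
    StageL2 P ρ ℱ n →L[ℝ] StageL2 P ρ ℱ n :=
  LinearMap.mkContinuous
    { toFun := fun u => (hc.exists_shift u).choose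
      map_add' := fun u v => lpMeas_ext (by
        have h := (hc.exists_shift (u + v)).choose_spec
        refine h.trans ?_
        refine ae_stageMeasure_iff.2 fun k => ?_
        filter_upwards [ae_stageMeasure_iff.1 (hc.exists_shift u).choose_spec k,
          ae_stageMeasure_iff.1 (hc.exists_shift v).choose_spec k,
          ae_stageMeasure_iff.1 (lpMeas_coeFn_add (hc.exists_shift u).choose
            (hc.exists_shift v).choose) k,
          ae_stageMeasure_iff.1 (shiftMul_congr_ae (c := c) (lpMeas_coeFn_add u v)) k]
          with ω h1 h2 h3 h4
        rw [h3, h1, h2, h4]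
        cases k <;> simp [shiftMul])
      map_smul' := fun a u => lpMeas_ext (by
        have h := (hc.exists_shift (a • u)).choose_spec
        refine h.trans ?_
        refine ae_stageMeasure_iff.2 fun k => ?_
        filter_upwards [ae_stageMeasure_iff.1 (hc.exists_shift u).choose_spec k,
          ae_stageMeasure_iff.1 (lpMeas_coeFn_smul a (hc.exists_shift u).choose) k,
          ae_stageMeasure_iff.1 (shiftMul_congr_ae (c := c) (lpMeas_coeFn_smul a u)) k]
          with ω h1 h2 h3
        rw [RingHom.id_apply, h2, h1, h3]
        cases k <;> simp [shiftMul, smul_comm a]) }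
    (Real.sqrt (Real.exp (-ρ))) fun u => by
      refine le_of_sq_le_sq ?_ (by positivity)
      rw [mul_pow, Real.sq_sqrt (Real.exp_nonneg _)]
      exact (norm_sq_shift hc (hc.exists_shift u).choose_spec).le

theorem IsUnitMultiplier.coeFn_shift (hc : IsUnitMultiplier P ℱ c) (u : StageL2 P ρ ℱ n) :
    (hc.shift ρ n u : ℕ × Ω → Vec n) =ᵐ[stageMeasure P ρ] shiftMul c u :=
  (hc.exists_shift u).choose_spec

/-- The shift by the constant multiplier `1` and the shift by the noise have orthogonal ranges, because
`E[w k | ℱ k] = 0`. -/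
theorem inner_shift_shift_eq_zero [IsProbabilityMeasure P] {w : ℕ → Ω → ℝ} (hw : IsNoise P ℱ w)
    (u v : StageL2 P ρ ℱ n) :
    inner ℝ ((isUnitMultiplier_one (P := P) (ℱ := ℱ)).shift ρ n u)
      (hw.isUnitMultiplier.shift ρ n v) = 0 := by
  obtain ⟨g, hg, hgu⟩ := u.exists_process
  obtain ⟨h, hh, hhv⟩ := v.exists_process
  rw [lpMeas_inner_eq, integral_stageMeasure (lpMeas_integrable_inner _ _)]
  refine (tsum_congr fun k => ?_).trans tsum_zero
  refine mul_eq_zero_of_right _ ?_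
  have h1 := ae_stageMeasure_iff.1
    (IsUnitMultiplier.coeFn_shift (isUnitMultiplier_one (P := P) (ℱ := ℱ)) u) k
  have h2 := ae_stageMeasure_iff.1 (hw.isUnitMultiplier.coeFn_shift v) k
  have hint : Integrable (fun ω => inner ℝ
      ((isUnitMultiplier_one (P := P) (ℱ := ℱ)).shift ρ n u (k, ω))
      (hw.isUnitMultiplier.shift ρ n v (k, ω))) P :=
    MemLp.integrable_inner_of_two (memLp_stageMeasure_section (Lp.memLp _) k)
      (memLp_stageMeasure_section (Lp.memLp _) k)
  cases k with
  | zero =>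
    rw [integral_congr_ae (g := fun _ => 0) (by
      filter_upwards [h1] with ω hω
      rw [hω]
      simp [shiftMul])]
    simp
  | succ k =>
    have e : (fun ω => inner ℝ ((isUnitMultiplier_one (P := P) (ℱ := ℱ)).shift ρ n u (k + 1, ω))
        (hw.isUnitMultiplier.shift ρ n v (k + 1, ω))) =ᵐ[P]
        (fun ω => inner ℝ (g k ω) (h k ω)) * w k := by
      filter_upwards [h1, h2, hgu k, hhv k] with ω e1 e2 e3 e4
      rw [e1, e2]
      simp only [shiftMul, e3, e4, one_smul, inner_smul_right, Pi.mul_apply]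
      ring
    have hfm : StronglyMeasurable[ℱ k] fun ω => inner ℝ (g k ω) (h k ω) :=
      (hg.1 k).inner (hh.1 k)
    have hpull := condExp_mul_of_stronglyMeasurable_left hfm (hint.congr e)
      ((hw.memLp k).integrable one_le_two)
    rw [integral_congr_ae e, ← integral_condExp (ℱ.le k), integral_congr_ae hpull,
      integral_congr_ae (g := fun _ => 0) (by
        filter_upwards [hw.mean_zero k] with ω hω
        rw [Pi.mul_apply, hω, mul_zero])]
    simp

theorem norm_sq_shift_add_shift [IsProbabilityMeasure P] {w : ℕ → Ω → ℝ} (hw : IsNoise P ℱ w)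
    (u v : StageL2 P ρ ℱ n) :
    ‖(isUnitMultiplier_one (P := P) (ℱ := ℱ)).shift ρ n u
      + hw.isUnitMultiplier.shift ρ n v‖ ^ 2 = Real.exp (-ρ) * (‖u‖ ^ 2 + ‖v‖ ^ 2) := by
  rw [norm_add_sq_real, inner_shift_shift_eq_zero hw,
    norm_sq_shift isUnitMultiplier_one (IsUnitMultiplier.coeFn_shift _ u),
    norm_sq_shift hw.isUnitMultiplier (IsUnitMultiplier.coeFn_shift _ v)]
  ring

/-- The scaled adjoint of a shift is a conditional expectation: both have the same integrals over the
sets of `ℱ k`. -/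
theorem condExp_ae_eq_scaledAdjoint_shift [IsFiniteMeasure P] (hc : IsUnitMultiplier P ℱ c)
    (hc' : ∀ k, MemLp (c k) 2 P) (y : StageL2 P ρ ℱ n) (k : ℕ) :
    (fun ω => scaledAdjoint (Real.exp (-ρ)) (hc.shift ρ n) y (k, ω)) =ᵐ[P]
      P[fun ω => c k ω • y (k + 1, ω) | ℱ k] := by
  have hr : Real.exp (-ρ) ≠ 0 := (Real.exp_pos _).ne'
  set D := scaledAdjoint (Real.exp (-ρ)) (hc.shift ρ n) y with hD
  obtain ⟨g, hg, hgD⟩ := D.exists_process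
  have hDint : Integrable (fun ω => D (k, ω)) P :=
    (memLp_stageMeasure_section (Lp.memLp _) k).integrable one_le_two
  have hy : MemLp (fun ω => y (k + 1, ω)) 2 P := memLp_stageMeasure_section (Lp.memLp _) (k + 1)
  have hcy : Integrable (fun ω => c k ω • y (k + 1, ω)) P := memLp_one_iff_integrable.1 (hy.smul (hc' k))
  refine ae_eq_condExp_of_forall_setIntegral_eq (ℱ.le k) hcy (fun _ _ _ => hDint.integrableOn)
    (fun A hA _ => ?_) ⟨g k, hg.1 k, hgD k⟩
  refine ext_inner_left ℝ fun e => ?_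
  rw [← integral_inner hDint.integrableOn, ← integral_inner hcy.integrableOn]
  -- Test the adjoint against the process equal to `1_A e` at time `k` and zero at other times.
  let v : ℕ → Ω → Vec n := fun j => if j = k then A.indicator fun _ => e else 0
  have hv : MemL2 P ℱ ρ v := by
    refine ⟨fun j => ?_, ?_⟩
    · by_cases hj : j = k
      · subst hj
        simpa [v] using stronglyMeasurable_const.indicator hA
      · simpa [v, hj] using stronglyMeasurable_zero
    · have hvm : ∀ j, AEStronglyMeasurable (v j) P := fun j => by
        by_cases hj : j = k
        · simpa [v, hj] using (stronglyMeasurable_const.indicator (ℱ.le k _ hA)).aestronglyMeasurable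
        · simpa [v, hj] using aestronglyMeasurable_zero
      rw [sqNorm_eq_lintegral hvm, lintegral_stageMeasure, tsum_eq_single k fun j hj => by
        simp [v, hj]]
      refine ENNReal.mul_lt_top ENNReal.ofReal_lt_top ?_
      refine (lintegral_mono (g := fun _ => ‖e‖ₑ ^ 2) fun ω => ?_).trans_lt ?_
      · simp only [v, if_true]
        gcongr
        exact enorm_indicator_le_enorm_self _ _
      · rw [lintegral_const]
        exact ENNReal.mul_lt_top (ENNReal.pow_lt_top enorm_lt_top) (measure_lt_top _ _)
  have hv' := hv.coeFn_toStageL2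
  have hsv := ae_stageMeasure_iff.1 (hc.coeFn_shift hv.toStageL2)
  have hdual := mul_inner_scaledAdjoint (Real.exp_pos (-ρ)) (hc.shift ρ n) hv.toStageL2 y
  rw [← hD, lpMeas_inner_eq, lpMeas_inner_eq, integral_stageMeasure (lpMeas_integrable_inner _ _),
    integral_stageMeasure (lpMeas_integrable_inner _ _), tsum_eq_single k, tsum_eq_single (k + 1)]
    at hdual
  · have e1 : ∫ ω, inner ℝ (hv.toStageL2 (k, ω)) (D (k, ω)) ∂P =
        ∫ ω in A, inner ℝ e (D (k, ω)) ∂P := by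
      rw [← integral_indicator (ℱ.le k _ hA)]
      refine integral_congr_ae ?_
      filter_upwards [hv' k] with ω h1
      rw [h1]
      by_cases hω : ω ∈ A <;> simp [v, hω]
    have e2 : ∫ ω, inner ℝ (hc.shift ρ n hv.toStageL2 (k + 1, ω)) (y (k + 1, ω)) ∂P =
        ∫ ω in A, inner ℝ e (c k ω • y (k + 1, ω)) ∂P := by
      rw [← integral_indicator (ℱ.le k _ hA)]
      refine integral_congr_ae ?_
      filter_upwards [hv' k, hsv (k + 1)] with ω h1 h2
      rw [h2]
      simp only [shiftMul, h1]
      by_cases hω : ω ∈ A <;> simp [v, hω, inner_smul_left, inner_smul_right]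
    rw [e1, e2, ← mul_assoc, ← Real.exp_add] at hdual
    have e3 : -ρ + -ρ * k = -ρ * ((k + 1 : ℕ) : ℝ) := by push_cast; ring
    rw [e3] at hdual
    exact mul_left_cancel₀ (Real.exp_pos _).ne' hdual
  · intro j hj
    refine mul_eq_zero_of_right _ ?_
    rw [integral_congr_ae (g := fun _ => 0), integral_zero]
    cases j with
    | zero =>
      filter_upwards [hsv 0] with ω h1
      rw [h1]
      simp [shiftMul]
    | succ j =>
      filter_upwards [hv' j, hsv (j + 1)] with ω h1 h2
      have hjk : j ≠ k := fun h => hj (by rw [h])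
      rw [h2]
      simp [shiftMul, h1, v, hjk]
  · intro j hj
    refine mul_eq_zero_of_right _ ?_
    rw [integral_congr_ae (g := fun _ => 0), integral_zero]
    filter_upwards [hv' j] with ω h1
    rw [h1]
    simp [v, hj]

end Shift

/-! ### From pointwise conditions to conditions in the Hilbert space -/

section Lifting

variable {X : Type*} {m m₀ : MeasurableSpace X} {μ : Measure X}
  {E : Type*} [NormedAddCommGroup E] [InnerProductSpace ℝ E]

/-- Integrated form of a pointwise monotonicity inequality. -/
theorem lpMeas_inner_add_le {f x b y s z d e : lpMeas E ℝ m 2 μ} {r κ : ℝ}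
    (h : ∀ᵐ p ∂μ, inner ℝ (f p) (x p) + r * inner ℝ (b p) (y p) + r * inner ℝ (s p) (z p) ≤
      -κ * (‖d p‖ ^ 2 + ‖e p‖ ^ 2)) :
    inner ℝ f x + r * inner ℝ b y + r * inner ℝ s z ≤ -κ * (‖d‖ ^ 2 + ‖e‖ ^ 2) := by
  have i1 := lpMeas_integrable_inner f x
  have i2 := (lpMeas_integrable_inner b y).const_mul r
  have i3 := (lpMeas_integrable_inner s z).const_mul r
  have i4 := lpMeas_integrable_inner d d
  have i5 := lpMeas_integrable_inner e e
  simp only [← real_inner_self_eq_norm_sq] at h ⊢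
  have := integral_mono_ae ((i1.add i2).add i3) ((i4.add i5).const_mul (-κ)) h
  rw [integral_add' (i1.add i2) i3, integral_add' i1 i2, integral_const_mul, integral_const_mul,
    integral_const_mul, integral_add' i4 i5] at this
  simpa only [lpMeas_inner_eq] using this

namespace IsLipschitzField

variable [CompleteSpace E] [SecondCountableTopology E] {C : ℝ} {φ : X → E → E → E → E}

theorem coeFn_superposition_sub (hm : m ≤ m₀) (h : IsLipschitzField m μ C φ)
    (x₁ x₂ y₁ y₂ z₁ z₂ : lpMeas E ℝ m 2 μ) :
    (h.superposition hm x₁ y₁ z₁ - h.superposition hm x₂ y₂ z₂ : lpMeas E ℝ m 2 μ) =ᵐ[μ]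
      fun p => φ p (x₁ p) (y₁ p) (z₁ p) - φ p (x₂ p) (y₂ p) (z₂ p) := by
  filter_upwards [lpMeas_coeFn_sub (h.superposition hm x₁ y₁ z₁) (h.superposition hm x₂ y₂ z₂),
    h.coeFn_superposition hm x₁ y₁ z₁, h.coeFn_superposition hm x₂ y₂ z₂] with p h1 h2 h3
  rw [h1, h2, h3]

theorem norm_superposition_sub_le (hm : m ≤ m₀) (h : IsLipschitzField m μ C φ) {a b c : ℝ}
    (ha : 0 ≤ a) (hb : 0 ≤ b) (hc : 0 ≤ c)
    (hlip : ∀ᵐ p ∂μ, ∀ x₁ x₂ y₁ y₂ z₁ z₂, ‖φ p x₁ y₁ z₁ - φ p x₂ y₂ z₂‖ ≤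
      a * ‖x₁ - x₂‖ + b * ‖y₁ - y₂‖ + c * ‖z₁ - z₂‖) (x₁ x₂ y₁ y₂ z₁ z₂ : lpMeas E ℝ m 2 μ) :
    ‖h.superposition hm x₁ y₁ z₁ - h.superposition hm x₂ y₂ z₂‖ ≤
      a * ‖x₁ - x₂‖ + b * ‖y₁ - y₂‖ + c * ‖z₁ - z₂‖ := by
  refine lpMeas_norm_le_of_ae_le ?_ ha hb hc
  filter_upwards [hlip, h.coeFn_superposition_sub hm x₁ x₂ y₁ y₂ z₁ z₂, lpMeas_coeFn_sub x₁ x₂,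
    lpMeas_coeFn_sub y₁ y₂, lpMeas_coeFn_sub z₁ z₂] with p h1 h2 h3 h4 h5
  rw [h2, h3, h4, h5]
  exact h1 _ _ _ _ _ _

end IsLipschitzField

end Lifting

section Transfer

/-- A monotonicity defect `μ r²` together with a domination condition `d ≤ r / μ` yields the defect
`μ³ d²`. -/
theorem neg_mul_sq_le_of_le {μ d r : ℝ} (hμ : 0 < μ) (hd : 0 ≤ d) (h : d ≤ 1 / μ * r) :
    -μ * r ^ 2 ≤ -μ ^ 3 * d ^ 2 := by
  have h' : μ * d ≤ r := by
    rw [one_div, ← div_eq_inv_mul, le_div_iff₀ hμ] at h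
    linarith
  have h'' : (μ * d) ^ 2 ≤ r ^ 2 := by gcongr
  nlinarith

variable {Ω : Type*} {mΩ : MeasurableSpace Ω} {n : ℕ} {P : Measure Ω} {ρ : ℝ}
  {ℱ : Filtration ℕ mΩ} {Φ : Coefficients Ω n} {ℓ : LipschitzConstants}

theorem isLipschitzField_stage {C : ℝ} {φ : ℕ → Ω → Vec n → Vec n → Vec n → Vec n}
    (hm : ∀ k x y z, StronglyMeasurable[ℱ k] fun ω => φ k ω x y z)
    (hl : ∀ k, ∀ᵐ ω ∂P, ∀ x₁ x₂ y₁ y₂ z₁ z₂, ‖φ k ω x₁ y₁ z₁ - φ k ω x₂ y₂ z₂‖ ≤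
      C * (‖x₁ - x₂‖ + ‖y₁ - y₂‖ + ‖z₁ - z₂‖))
    (h0 : MemL2 P ℱ ρ fun k ω => φ k ω 0 0 0) :
    IsLipschitzField (stageSpace ℱ) (stageMeasure P ρ) C fun p => φ p.1 p.2 where
  meas x y z := stronglyMeasurable_stageSpace_iff.2 fun k => hm k x y z
  lip := ae_stageMeasure_iff.2 hl
  memLp := h0.memLp

namespace LipschitzAssumption

theorem isLipschitzField_b (hΦ : LipschitzAssumption P ℱ ρ ℓ Φ) :
    IsLipschitzField (stageSpace ℱ) (stageMeasure P ρ) (ℓ.L₁ + ℓ.L₃ + ℓ.L₄)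
      fun p => Φ.b p.1 p.2 := by
  refine isLipschitzField_stage hΦ.meas_b (fun k => ?_) hΦ.memL2_b
  filter_upwards [hΦ.lip_b k] with ω hω x₁ x₂ y₁ y₂ z₁ z₂
  refine (hω _ _ _ _ _ _).trans ?_
  have := ℓ.L₁_pos
  have := ℓ.L₃_pos
  have := ℓ.L₄_pos
  nlinarith [norm_nonneg (x₁ - x₂), norm_nonneg (y₁ - y₂), norm_nonneg (z₁ - z₂)]

theorem isLipschitzField_σ (hΦ : LipschitzAssumption P ℱ ρ ℓ Φ) :
    IsLipschitzField (stageSpace ℱ) (stageMeasure P ρ) (ℓ.L₁ + ℓ.L₅ + ℓ.L₆)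
      fun p => Φ.σ p.1 p.2 := by
  refine isLipschitzField_stage hΦ.meas_σ (fun k => ?_) hΦ.memL2_σ
  filter_upwards [hΦ.lip_σ k] with ω hω x₁ x₂ y₁ y₂ z₁ z₂
  refine (hω _ _ _ _ _ _).trans ?_
  have := ℓ.L₁_pos
  have := ℓ.L₅_pos
  have := ℓ.L₆_pos
  nlinarith [norm_nonneg (x₁ - x₂), norm_nonneg (y₁ - y₂), norm_nonneg (z₁ - z₂)]

theorem isLipschitzField_f (hΦ : LipschitzAssumption P ℱ ρ ℓ Φ) :
    IsLipschitzField (stageSpace ℱ) (stageMeasure P ρ) (ℓ.L₇ + ℓ.L₂)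
      fun p => Φ.f (p.1 + 1) p.2 := by
  refine isLipschitzField_stage (φ := fun k => Φ.f (k + 1)) hΦ.meas_f (fun k => ?_) hΦ.memL2_f
  filter_upwards [hΦ.lip_f k] with ω hω x₁ x₂ y₁ y₂ z₁ z₂
  refine (hω _ _ _ _ _ _).trans ?_
  have := ℓ.L₂_pos
  have := ℓ.L₇_pos
  nlinarith [norm_nonneg (x₁ - x₂), norm_nonneg (y₁ - y₂), norm_nonneg (z₁ - z₂)]

theorem norm_initial_sub_le (hΦ : LipschitzAssumption P ℱ ρ ℓ Φ) (k : ℕ) (y₁ y₂ : Vec n) :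
    ‖(if k = 0 then Φ.Λ y₁ else 0) - (if k = 0 then Φ.Λ y₂ else 0)‖ ≤ ℓ.L * ‖y₁ - y₂‖ := by
  have := ℓ.L_pos
  split_ifs
  · exact hΦ.lip_Λ y₁ y₂
  · rw [sub_self, norm_zero]
    positivity

theorem isLipschitzField_Λ [IsFiniteMeasure P] (hΦ : LipschitzAssumption P ℱ ρ ℓ Φ) :
    IsLipschitzField (stageSpace ℱ) (stageMeasure P ρ) ℓ.L
      fun p _ y _ => if p.1 = 0 then Φ.Λ y else 0 := by
  refine isLipschitzField_stage (φ := fun k _ _ y _ => if k = 0 then Φ.Λ y else 0)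
    (fun k _ _ _ => stronglyMeasurable_const) (fun k => .of_forall fun ω x₁ x₂ y₁ y₂ z₁ z₂ => ?_)
    ⟨fun k => stronglyMeasurable_const, ?_⟩
  · refine (hΦ.norm_initial_sub_le k y₁ y₂).trans ?_
    have := ℓ.L_pos
    gcongr
    linarith [norm_nonneg (x₁ - x₂), norm_nonneg (z₁ - z₂)]
  · rw [sqNorm_eq_lintegral fun k => aestronglyMeasurable_const, lintegral_stageMeasure,
      tsum_eq_single 0 fun k hk => by simp [hk]]
    refine ENNReal.mul_lt_top ENNReal.ofReal_lt_top ?_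
    simp only [if_true, lintegral_const]
    exact ENNReal.mul_lt_top (ENNReal.pow_lt_top enorm_lt_top) (measure_lt_top _ _)

/-- The superposition operators of the coefficients on the weighted space. The initial map `Λ` acts
at time `0` and is zero at later times. -/
noncomputable def toHilbert [IsFiniteMeasure P] (hΦ : LipschitzAssumption P ℱ ρ ℓ Φ) :
    HilbertCoefficients (StageL2 P ρ ℱ n) where
  Λ y := hΦ.isLipschitzField_Λ.superposition (stageSpace_le ℱ) 0 y 0
  b := hΦ.isLipschitzField_b.superposition (stageSpace_le ℱ)
  σ := hΦ.isLipschitzField_σ.superposition (stageSpace_le ℱ)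
  f := hΦ.isLipschitzField_f.superposition (stageSpace_le ℱ)

theorem isLipschitz_toHilbert [IsFiniteMeasure P] (hΦ : LipschitzAssumption P ℱ ρ ℓ Φ) :
    hΦ.toHilbert.IsLipschitz ℓ where
  lip_Λ y₁ y₂ := by
    have h := hΦ.isLipschitzField_Λ.norm_superposition_sub_le (stageSpace_le ℱ) le_rfl ℓ.L_pos.le
      le_rfl (.of_forall fun p x₁ x₂ y₁ y₂ z₁ z₂ => by
        simpa using hΦ.norm_initial_sub_le p.1 y₁ y₂) 0 0 y₁ y₂ 0 0
    exact h.trans_eq (by simp)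
  lip_b := hΦ.isLipschitzField_b.norm_superposition_sub_le (stageSpace_le ℱ) ℓ.L₁_pos.le ℓ.L₃_pos.le ℓ.L₄_pos.le
    (ae_stageMeasure_iff.2 hΦ.lip_b)
  lip_σ := hΦ.isLipschitzField_σ.norm_superposition_sub_le (stageSpace_le ℱ) ℓ.L₁_pos.le ℓ.L₅_pos.le ℓ.L₆_pos.le
    (ae_stageMeasure_iff.2 hΦ.lip_σ)
  lip_f x₁ x₂ y₁ y₂ z₁ z₂ := by
    have h := hΦ.isLipschitzField_f.norm_superposition_sub_le (stageSpace_le ℱ) ℓ.L₇_pos.le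
      ℓ.L₂_pos.le ℓ.L₂_pos.le (ae_stageMeasure_iff.2 (by simpa only [mul_add, add_assoc] using hΦ.lip_f))
      x₁ x₂ y₁ y₂ z₁ z₂
    exact h.trans_eq (by ring)

variable {m : ℕ} {μ ν : ℝ} {M : Matrix (Fin m) (Fin n) ℝ}
  {A B C : ℕ → Ω → Matrix (Fin m) (Fin n) ℝ}

theorem forwardMonotone [IsFiniteMeasure P] (hΦ : LipschitzAssumption P ℱ ρ ℓ Φ)
    (h : DominationMonotonicity P ρ μ ν M A B C Φ) (hμ : 0 < μ) (hν : ν = 0) :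
    hΦ.toHilbert.ForwardMonotone (Real.exp (-ρ)) (μ ^ 3 / 2) where
  mono_Λ y₁ y₂ := by
    -- Only the first inner product is present in the condition on `Λ`.
    have := lpMeas_inner_add_le (μ := stageMeasure P ρ) (m := stageSpace ℱ)
      (f := hΦ.toHilbert.Λ y₁ - hΦ.toHilbert.Λ y₂) (x := y₁ - y₂) (b := 0)
      (y := 0) (s := 0) (z := 0) (d := hΦ.toHilbert.Λ y₁ - hΦ.toHilbert.Λ y₂) (e := 0) (r := 0)
      (κ := μ ^ 3 / 2) ?_
    · simpa using this
    filter_upwards [hΦ.isLipschitzField_Λ.coeFn_superposition_sub (stageSpace_le ℱ) 0 0 y₁ y₂ 0 0,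
      lpMeas_coeFn_sub y₁ y₂, lpMeas_coeFn_zero (E := Vec n) (m := stageSpace ℱ)
        (μ := stageMeasure P ρ)] with p h1 h2 h3
    simp only [toHilbert, h1, h2, h3, zero_mul, add_zero, norm_zero, ne_eq, OfNat.ofNat_ne_zero,
      not_false_eq_true, zero_pow]
    split_ifs
    · have e1 := h.mono_Λ (y₁ p) (y₂ p)
      have e2 := neg_mul_sq_le_of_le hμ (norm_nonneg _) (h.dom_Λ hμ.ne' (y₁ p) (y₂ p))
      have e3 : 0 ≤ μ ^ 3 * ‖Φ.Λ (y₁ p) - Φ.Λ (y₂ p)‖ ^ 2 := by positivity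
      linarith
    · simp
  mono x₁ x₂ y₁ y₂ z₁ z₂ := by
    refine lpMeas_inner_add_le ?_
    filter_upwards [hΦ.isLipschitzField_f.coeFn_superposition_sub (stageSpace_le ℱ) x₁ x₂ y₁ y₂ z₁ z₂,
      hΦ.isLipschitzField_b.coeFn_superposition_sub (stageSpace_le ℱ) x₁ x₂ y₁ y₂ z₁ z₂,
      hΦ.isLipschitzField_σ.coeFn_superposition_sub (stageSpace_le ℱ) x₁ x₂ y₁ y₂ z₁ z₂,
      hΦ.isLipschitzField_b.coeFn_superposition_sub (stageSpace_le ℱ) x₁ x₁ y₁ y₂ z₁ z₂,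
      hΦ.isLipschitzField_σ.coeFn_superposition_sub (stageSpace_le ℱ) x₁ x₁ y₁ y₂ z₁ z₂,
      lpMeas_coeFn_sub x₁ x₂, lpMeas_coeFn_sub y₁ y₂, lpMeas_coeFn_sub z₁ z₂,
      ae_stageMeasure_of_forall (ρ := ρ) h.mono_Γ, ae_stageMeasure_of_forall (ρ := ρ) (h.dom_b hμ.ne'),
      ae_stageMeasure_of_forall (ρ := ρ) (h.dom_σ hμ.ne')] with p h1 h2 h3 h4 h5 h6 h7 h8 h9 h10 h11
    simp only [toHilbert, h1, h2, h3, h4, h5, h6, h7, h8]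
    have e1 := h9 (x₁ p) (x₂ p) (y₁ p) (y₂ p) (z₁ p) (z₂ p)
    have e2 := neg_mul_sq_le_of_le hμ (norm_nonneg _) (h10 (x₁ p) (y₁ p) (y₂ p) (z₁ p) (z₂ p))
    have e3 := neg_mul_sq_le_of_le hμ (norm_nonneg _) (h11 (x₁ p) (y₁ p) (y₂ p) (z₁ p) (z₂ p))
    rw [hν] at e1
    linarith

theorem backwardMonotone [IsFiniteMeasure P] (hΦ : LipschitzAssumption P ℱ ρ ℓ Φ)
    (h : DominationMonotonicity P ρ μ ν M A B C Φ) (hμ : μ = 0) (hν : 0 < ν) :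
    hΦ.toHilbert.BackwardMonotone (Real.exp (-ρ)) (ν ^ 3) where
  mono_Λ y₁ y₂ := by
    have := lpMeas_inner_add_le (μ := stageMeasure P ρ) (m := stageSpace ℱ)
      (f := hΦ.toHilbert.Λ y₁ - hΦ.toHilbert.Λ y₂) (x := y₁ - y₂) (b := 0)
      (y := 0) (s := 0) (z := 0) (d := 0) (e := 0) (r := 0) (κ := 0) ?_
    · simpa using this
    filter_upwards [hΦ.isLipschitzField_Λ.coeFn_superposition_sub (stageSpace_le ℱ) 0 0 y₁ y₂ 0 0,
      lpMeas_coeFn_sub y₁ y₂] with p h1 h2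
    simp only [toHilbert, h1, h2, zero_mul, add_zero, neg_zero]
    split_ifs
    · simpa [hμ] using h.mono_Λ (y₁ p) (y₂ p)
    · simp
  mono x₁ x₂ y₁ y₂ z₁ z₂ := by
    have := lpMeas_inner_add_le (μ := stageMeasure P ρ) (m := stageSpace ℱ)
      (f := hΦ.toHilbert.f x₁ y₁ z₁ - hΦ.toHilbert.f x₂ y₂ z₂) (x := x₁ - x₂)
      (b := hΦ.toHilbert.b x₁ y₁ z₁ - hΦ.toHilbert.b x₂ y₂ z₂) (y := y₁ - y₂)
      (s := hΦ.toHilbert.σ x₁ y₁ z₁ - hΦ.toHilbert.σ x₂ y₂ z₂) (z := z₁ - z₂)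
      (d := hΦ.toHilbert.f x₁ y₁ z₁ - hΦ.toHilbert.f x₂ y₁ z₁) (e := 0) (r := Real.exp (-ρ))
      (κ := ν ^ 3) ?_
    · simpa using this
    filter_upwards [hΦ.isLipschitzField_f.coeFn_superposition_sub (stageSpace_le ℱ) x₁ x₂ y₁ y₂ z₁ z₂,
      hΦ.isLipschitzField_b.coeFn_superposition_sub (stageSpace_le ℱ) x₁ x₂ y₁ y₂ z₁ z₂,
      hΦ.isLipschitzField_σ.coeFn_superposition_sub (stageSpace_le ℱ) x₁ x₂ y₁ y₂ z₁ z₂,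
      hΦ.isLipschitzField_f.coeFn_superposition_sub (stageSpace_le ℱ) x₁ x₂ y₁ y₁ z₁ z₁,
      lpMeas_coeFn_sub x₁ x₂, lpMeas_coeFn_sub y₁ y₂, lpMeas_coeFn_sub z₁ z₂,
      lpMeas_coeFn_zero (E := Vec n) (m := stageSpace ℱ) (μ := stageMeasure P ρ),
      ae_stageMeasure_of_forall (ρ := ρ) h.mono_Γ, ae_stageMeasure_of_forall (ρ := ρ) (h.dom_f hν.ne')]
      with p h1 h2 h3 h4 h5 h6 h7 h8 h9 h10
    simp only [toHilbert, h1, h2, h3, h4, h5, h6, h7, h8, norm_zero, ne_eq, OfNat.ofNat_ne_zero,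
      not_false_eq_true, zero_pow, add_zero]
    have e1 := h9 (x₁ p) (x₂ p) (y₁ p) (y₂ p) (z₁ p) (z₂ p)
    have e2 := neg_mul_sq_le_of_le hν (norm_nonneg _) (h10 (x₁ p) (x₂ p) (y₁ p) (z₁ p))
    rw [hμ] at e1
    linarith

end LipschitzAssumption

end Transfer

/-! ### Solutions of the forward-backward equation -/

section Solutions

/-- The shift by one time step. -/
noncomputable abbrev timeShift {Ω : Type*} {mΩ : MeasurableSpace Ω} (P : Measure Ω) (ρ : ℝ)
    (ℱ : Filtration ℕ mΩ) (n : ℕ) : StageL2 P ρ ℱ n →L[ℝ] StageL2 P ρ ℱ n :=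
  (isUnitMultiplier_one (P := P) (ℱ := ℱ)).shift ρ n

variable {Ω : Type*} {mΩ : MeasurableSpace Ω} {n : ℕ} {P : Measure Ω} {ρ : ℝ}
  {ℱ : Filtration ℕ mΩ} {Φ : Coefficients Ω n} {ℓ : LipschitzConstants} {w : ℕ → Ω → ℝ}

/-- The squared norms of four elements of the weighted space, bounded by an integral of the form that
defines `dataSize` and `dataDiff`. -/
theorem enorm_sq_add_le {b σ f Λ : StageL2 P ρ ℱ n} {β s φ : ℕ → Ω → Vec n} {l : Ω → Vec n}
    (hb : ∀ k, ∀ᵐ ω ∂P, b (k, ω) = β k ω) (hσ : ∀ k, ∀ᵐ ω ∂P, σ (k, ω) = s k ω)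
    (hf : ∀ k, ∀ᵐ ω ∂P, f (k, ω) = φ k ω)
    (hΛ : ∀ k, ∀ᵐ ω ∂P, Λ (k, ω) = if k = 0 then l ω else 0) :
    ‖b‖ₑ ^ 2 + ‖σ‖ₑ ^ 2 + ENNReal.ofReal (Real.exp (-ρ)) * ‖f‖ₑ ^ 2 + ‖Λ‖ₑ ^ 2 ≤
      ∫⁻ ω, ((∑' k : ℕ, ENNReal.ofReal (Real.exp (-ρ * k)) * ‖β k ω‖ₑ ^ 2)
        + (∑' k : ℕ, ENNReal.ofReal (Real.exp (-ρ * k)) * ‖s k ω‖ₑ ^ 2)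
        + (∑' k : ℕ, ENNReal.ofReal (Real.exp (-ρ * (k + 1))) * ‖φ k ω‖ₑ ^ 2)
        + ‖l ω‖ₑ ^ 2) ∂P := by
  have e1 : ENNReal.ofReal (Real.exp (-ρ)) * ‖f‖ₑ ^ 2 =
      ∫⁻ ω, ∑' k : ℕ, ENNReal.ofReal (Real.exp (-ρ * (k + 1))) * ‖φ k ω‖ₑ ^ 2 ∂P := by
    rw [← sqNorm_eq_enorm_sq hf, sqNorm, ← lintegral_const_mul' _ _ ENNReal.ofReal_ne_top]
    refine lintegral_congr fun ω => ?_
    rw [← ENNReal.tsum_mul_left]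
    refine tsum_congr fun k => ?_
    rw [← mul_assoc, ← ENNReal.ofReal_mul (Real.exp_nonneg _), ← Real.exp_add]
    ring_nf
  have e2 : ‖Λ‖ₑ ^ 2 = ∫⁻ ω, ‖l ω‖ₑ ^ 2 ∂P := by
    rw [lpMeas_enorm_sq, lintegral_stageMeasure, tsum_eq_single 0]
    · simp only [Nat.cast_zero, mul_zero, Real.exp_zero, ENNReal.ofReal_one, one_mul]
      refine lintegral_congr_ae ?_
      filter_upwards [hΛ 0] with ω h
      rw [h, if_pos rfl]
    · intro k hk
      refine mul_eq_zero_of_right _ ?_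
      rw [lintegral_congr_ae (g := fun _ => 0), lintegral_zero]
      filter_upwards [hΛ k] with ω h
      rw [h, if_neg hk]
      simp
  rw [e1, e2, ← sqNorm_eq_enorm_sq hb, ← sqNorm_eq_enorm_sq hσ, sqNorm, sqNorm]
  exact (add_le_add_left ((add_le_add_left (le_lintegral_add _ _) _).trans
    (le_lintegral_add _ _)) _).trans (le_lintegral_add _ _)

theorem ae_eq_of_sqNorm_sub_eq_zero {g g' : ℕ → Ω → Vec n} (hg : MemL2 P ℱ ρ g)
    (hg' : MemL2 P ℱ ρ g') (h : sqNorm P ρ (fun k ω => g k ω - g' k ω) = 0) (k : ℕ) :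
    g k =ᵐ[P] g' k := by
  have hm : ∀ k, AEStronglyMeasurable (fun ω => g k ω - g' k ω) P := fun k =>
    (((hg.1 k).sub (hg'.1 k)).mono (ℱ.le k)).aestronglyMeasurable
  rw [sqNorm_eq_lintegral hm, lintegral_stageMeasure, ENNReal.tsum_eq_zero] at h
  have hk := (mul_eq_zero.1 (h k)).resolve_left (ENNReal.ofReal_pos.2 (Real.exp_pos _)).ne'
  rw [lintegral_eq_zero_iff' ((hm k).enorm.pow_const 2)] at hk
  filter_upwards [hk] with ω hω
  simpa [sub_eq_zero] using hω

variable [IsProbabilityMeasure P]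

/-- The shift by one time step combined with multiplication by the noise. -/
noncomputable abbrev IsNoise.noiseShift (hw : IsNoise P ℱ w) (ρ : ℝ) (n : ℕ) :
    StageL2 P ρ ℱ n →L[ℝ] StageL2 P ρ ℱ n :=
  hw.isUnitMultiplier.shift ρ n

theorem condY_ae_eq {Y : StageL2 P ρ ℱ n} {y : ℕ → Ω → Vec n}
    (hy : ∀ k, ∀ᵐ ω ∂P, Y (k, ω) = y k ω) (k : ℕ) :
    ∀ᵐ ω ∂P, scaledAdjoint (Real.exp (-ρ)) (timeShift P ρ ℱ n) Y (k, ω) = condY P ℱ y k ω := by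
  refine (condExp_ae_eq_scaledAdjoint_shift isUnitMultiplier_one (fun _ => memLp_const 1) Y k).trans
    (condExp_congr_ae ?_)
  filter_upwards [hy (k + 1)] with ω hω
  rw [one_smul, hω]

theorem condZ_ae_eq (hw : IsNoise P ℱ w) {Y : StageL2 P ρ ℱ n} {y : ℕ → Ω → Vec n}
    (hy : ∀ k, ∀ᵐ ω ∂P, Y (k, ω) = y k ω) (k : ℕ) :
    ∀ᵐ ω ∂P, scaledAdjoint (Real.exp (-ρ)) (hw.noiseShift ρ n) Y (k, ω) = condZ P ℱ w y k ω := by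
  refine (condExp_ae_eq_scaledAdjoint_shift hw.isUnitMultiplier hw.memLp Y k).trans
    (condExp_congr_ae ?_)
  filter_upwards [hy (k + 1)] with ω hω
  rw [hω]

namespace LipschitzAssumption

/-- The values of the superposition operators along processes `x`, `y`, `z`. The initial map acts on the
second one. -/
theorem coeFn_toHilbert (hΦ : LipschitzAssumption P ℱ ρ ℓ Φ) {X Y Z : StageL2 P ρ ℱ n}
    {x y z : ℕ → Ω → Vec n} (hx : ∀ k, ∀ᵐ ω ∂P, X (k, ω) = x k ω)
    (hy : ∀ k, ∀ᵐ ω ∂P, Y (k, ω) = y k ω) (hz : ∀ k, ∀ᵐ ω ∂P, Z (k, ω) = z k ω) (k : ℕ) :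
    ∀ᵐ ω ∂P, hΦ.toHilbert.b X Y Z (k, ω) = Φ.b k ω (x k ω) (y k ω) (z k ω) ∧
      hΦ.toHilbert.σ X Y Z (k, ω) = Φ.σ k ω (x k ω) (y k ω) (z k ω) ∧
      hΦ.toHilbert.f X Y Z (k, ω) = Φ.f (k + 1) ω (x k ω) (y k ω) (z k ω) ∧
      hΦ.toHilbert.Λ Y (k, ω) = if k = 0 then Φ.Λ (y 0 ω) else 0 := by
  filter_upwards [hx k, hy k, hz k,
    ae_stageMeasure_iff.1 (hΦ.isLipschitzField_b.coeFn_superposition (stageSpace_le ℱ) X Y Z) k,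
    ae_stageMeasure_iff.1 (hΦ.isLipschitzField_σ.coeFn_superposition (stageSpace_le ℱ) X Y Z) k,
    ae_stageMeasure_iff.1 (hΦ.isLipschitzField_f.coeFn_superposition (stageSpace_le ℱ) X Y Z) k,
    ae_stageMeasure_iff.1 (hΦ.isLipschitzField_Λ.coeFn_superposition (stageSpace_le ℱ) 0 Y 0) k]
    with ω h1 h2 h3 h4 h5 h6 h7
  simp only [toHilbert, h4, h5, h6, h7, h1, h2, h3, true_and]
  split_ifs with hk
  · subst hk; rfl
  · rfl

/-- Solutions of the forward-backward equation are the fixed points of `rhs`. -/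
theorem eq_rhs_iff (hw : IsNoise P ℱ w) (hΦ : LipschitzAssumption P ℱ ρ ℓ Φ)
    {X Y : StageL2 P ρ ℱ n} {x y : ℕ → Ω → Vec n} (hx : ∀ k, ∀ᵐ ω ∂P, X (k, ω) = x k ω)
    (hy : ∀ k, ∀ᵐ ω ∂P, Y (k, ω) = y k ω) (hx' : MemL2 P ℱ ρ x) (hy' : MemL2 P ℱ ρ y) :
    (X, Y) = hΦ.toHilbert.rhs (Real.exp (-ρ)) (timeShift P ρ ℱ n) (hw.noiseShift ρ n) (X, Y) ↔
      IsSolution P ℱ w ρ Φ x y := by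
  have hY := condY_ae_eq hy
  have hZ := condZ_ae_eq hw hy
  have hc := hΦ.coeFn_toHilbert hx hY hZ
  have hΛ := hΦ.coeFn_toHilbert hx hy hZ
  set D₁ := scaledAdjoint (Real.exp (-ρ)) (timeShift P ρ ℱ n) Y
  set D₂ := scaledAdjoint (Real.exp (-ρ)) (hw.noiseShift ρ n) Y
  set b := hΦ.toHilbert.b X D₁ D₂
  set σ := hΦ.toHilbert.σ X D₁ D₂
  have h1 : ∀ k, ∀ᵐ ω ∂P, (timeShift P ρ ℱ n b + hw.noiseShift ρ n σ + hΦ.toHilbert.Λ Y :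
      StageL2 P ρ ℱ n) (k, ω) = shiftMul (fun _ _ => 1) b (k, ω) + shiftMul w σ (k, ω)
        + if k = 0 then Φ.Λ (y 0 ω) else 0 := by
    intro k
    filter_upwards [ae_stageMeasure_iff.1 (lpMeas_coeFn_add
        (timeShift P ρ ℱ n b + hw.noiseShift ρ n σ) (hΦ.toHilbert.Λ Y)) k,
      ae_stageMeasure_iff.1 (lpMeas_coeFn_add (timeShift P ρ ℱ n b) (hw.noiseShift ρ n σ)) k,
      ae_stageMeasure_iff.1 (IsUnitMultiplier.coeFn_shift
        (isUnitMultiplier_one (P := P) (ℱ := ℱ)) b) k,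
      ae_stageMeasure_iff.1 (hw.isUnitMultiplier.coeFn_shift σ) k, hΛ k] with ω e1 e2 e3 e4 e5
    rw [e1, e2, e3, e4, e5.2.2.2]
  have h2 : ∀ k, ∀ᵐ ω ∂P, (-hΦ.toHilbert.f X D₁ D₂ : StageL2 P ρ ℱ n) (k, ω) =
      -Φ.f (k + 1) ω (x k ω) (condY P ℱ y k ω) (condZ P ℱ w y k ω) := by
    intro k
    filter_upwards [ae_stageMeasure_iff.1 (lpMeas_coeFn_neg (hΦ.toHilbert.f X D₁ D₂)) k, hc k]
      with ω e1 e2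
    rw [e1, e2.2.2.1]
  constructor
  · intro h
    have hX : X = timeShift P ρ ℱ n b + hw.noiseShift ρ n σ + hΦ.toHilbert.Λ Y :=
      congrArg Prod.fst h
    have hYf : Y = -hΦ.toHilbert.f X D₁ D₂ := congrArg Prod.snd h
    rw [← hX] at h1
    rw [← hYf] at h2
    refine ⟨hx', hy', fun k => ?_, fun k => ?_, ?_⟩
    · filter_upwards [h1 (k + 1), hx (k + 1), hc k] with ω e1 e2 e3
      rw [← e2, e1]
      simp [shiftMul, e3.1, e3.2.1]
    · filter_upwards [h2 k, hy k] with ω e1 e2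
      rw [← e2, e1]
    · filter_upwards [h1 0, hx 0] with ω e1 e2
      rw [← e2, e1]
      simp [shiftMul]
  · intro h
    refine Prod.ext (lpMeas_ext (ae_stageMeasure_iff.2 fun k => ?_))
      (lpMeas_ext (ae_stageMeasure_iff.2 fun k => ?_))
    · cases k with
      | zero =>
        filter_upwards [h1 0, hx 0, h.initial] with ω e1 e2 e3
        refine Eq.trans ?_ e1.symm
        rw [e2, e3]
        simp [shiftMul]
      | succ k =>
        filter_upwards [h1 (k + 1), hx (k + 1), hc k, h.forward k] with ω e1 e2 e3 e4
        refine Eq.trans ?_ e1.symm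
        rw [e2, e4]
        simp [shiftMul, e3.1, e3.2.1]
    · filter_upwards [h2 k, hy k, h.backward k] with ω e1 e2 e3
      refine Eq.trans ?_ e1.symm
      rw [e2, e3]

end LipschitzAssumption

/-- The constant of the growth and stability bounds; the last factor dominates `e^{-ρ}` and `e^{ρ}` for
all admissible weights `ρ`. -/
noncomputable def growthConst (ℓ : LipschitzConstants) (κ : ℝ) : ℝ :=
  3 * stabilityConst ℓ κ ^ 2 * (1 / (4 * ℓ.L₁ ^ 2) + 1 / (6 * ℓ.L₂ ^ 2) + 1)

theorem growthConst_pos (ℓ : LipschitzConstants) {κ : ℝ} (hκ : 0 < κ) : 0 < growthConst ℓ κ := by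
  have := stabilityConst_pos ℓ hκ
  have := ℓ.L₁_pos
  have := ℓ.L₂_pos
  unfold growthConst
  positivity

theorem four_mul_sq_mul_exp_lt_one (hρ : Real.log (4 * ℓ.L₁ ^ 2) < ρ) :
    4 * ℓ.L₁ ^ 2 * Real.exp (-ρ) < 1 := by
  have := ℓ.L₁_pos
  rw [Real.log_lt_iff_lt_exp (by positivity)] at hρ
  rw [Real.exp_neg, ← div_eq_mul_inv, div_lt_one (Real.exp_pos _)]
  exact hρ

theorem six_mul_sq_lt_exp (hρ : ρ < -Real.log (6 * ℓ.L₂ ^ 2)) :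
    6 * ℓ.L₂ ^ 2 < Real.exp (-ρ) := by
  have := ℓ.L₂_pos
  rw [← Real.log_lt_iff_lt_exp (by positivity)]
  linarith

variable {κ : ℝ}

/-- The bounds on `ρ` in terms of `t = e^{-ρ/2}`: they leave a margin of factor `√2` in the forward and
of `√3` in the backward equation, so that constants independent of `ρ` are possible. -/
theorem exists_sqrt_exp (hρ : Real.log (4 * ℓ.L₁ ^ 2) < ρ) (hρ' : ρ < -Real.log (6 * ℓ.L₂ ^ 2)) :
    ∃ t : ℝ, 0 < t ∧ 2 * ℓ.L₁ * t ≤ 1 ∧ 2 * ℓ.L₂ ≤ t ∧ Real.exp (-ρ) = t ^ 2 := by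
  have h1 := four_mul_sq_mul_exp_lt_one hρ
  have h2 := six_mul_sq_lt_exp hρ'
  have e : Real.exp (-ρ) = Real.exp (-ρ / 2) ^ 2 := by
    rw [← Real.exp_nat_mul]
    congr 1
    push_cast
    ring
  have hL1 := ℓ.L₁_pos
  refine ⟨Real.exp (-ρ / 2), Real.exp_pos _, ?_, ?_, e⟩
  · refine le_of_sq_le_sq ?_ zero_le_one
    rw [mul_pow, ← e]
    linarith
  · refine le_of_sq_le_sq ?_ (Real.exp_pos _).le
    rw [← e]
    linarith [sq_nonneg ℓ.L₂]

theorem exists_isSolution (hw : IsNoise P ℱ w) (hρ : Real.log (4 * ℓ.L₁ ^ 2) < ρ)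
    (hρ' : ρ < -Real.log (6 * ℓ.L₂ ^ 2)) (hΦ : LipschitzAssumption P ℱ ρ ℓ Φ) (hκ : 0 < κ)
    (hm : hΦ.toHilbert.ForwardMonotone (Real.exp (-ρ)) κ ∨
      hΦ.toHilbert.BackwardMonotone (Real.exp (-ρ)) κ) :
    ∃ x y : ℕ → Ω → Vec n, IsSolution P ℱ w ρ Φ x y := by
  obtain ⟨t, ht, h1, h2, e⟩ := exists_sqrt_exp hρ hρ'
  have hS := norm_sq_shift_add_shift (ρ := ρ) (n := n) hw
  have hiff := @LipschitzAssumption.eq_rhs_iff Ω mΩ n P ρ ℱ Φ ℓ w _ hw hΦ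
  rw [e] at hm hS hiff
  obtain ⟨⟨X, Y⟩, hu⟩ := exists_eq_rhs ht h1 h2 hκ hS hΦ.isLipschitz_toHilbert hm
  obtain ⟨x, hx, hx'⟩ := X.exists_process
  obtain ⟨y, hy, hy'⟩ := Y.exists_process
  exact ⟨x, y, (hiff hx' hy' hx hy).1 hu⟩

/-- The stability bound of `norm_sq_sub_le_of_eq_rhs` with a constant independent of `ρ`, the weight
`e^{-ρ}` being absorbed into the norm of `f`. -/
theorem enorm_sq_sub_le (hw : IsNoise P ℱ w) (hρ : Real.log (4 * ℓ.L₁ ^ 2) < ρ)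
    (hρ' : ρ < -Real.log (6 * ℓ.L₂ ^ 2)) (hΦ : LipschitzAssumption P ℱ ρ ℓ Φ) (hκ : 0 < κ)
    (hm : hΦ.toHilbert.ForwardMonotone (Real.exp (-ρ)) κ ∨
      hΦ.toHilbert.BackwardMonotone (Real.exp (-ρ)) κ)
    {u : StageL2 P ρ ℱ n × StageL2 P ρ ℱ n}
    (hu : u = hΦ.toHilbert.rhs (Real.exp (-ρ)) (timeShift P ρ ℱ n) (hw.noiseShift ρ n) u)
    {v : StageL2 P ρ ℱ n × StageL2 P ρ ℱ n} {b σ Λ f : StageL2 P ρ ℱ n}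
    (hv₁ : (hΦ.toHilbert.rhs (Real.exp (-ρ)) (timeShift P ρ ℱ n) (hw.noiseShift ρ n) v - v).1 =
      timeShift P ρ ℱ n b + hw.noiseShift ρ n σ + Λ)
    (hv₂ : (hΦ.toHilbert.rhs (Real.exp (-ρ)) (timeShift P ρ ℱ n) (hw.noiseShift ρ n) v - v).2 =
      -f) :
    ‖u.1 - v.1‖ₑ ^ 2 + ‖u.2 - v.2‖ₑ ^ 2 ≤ ENNReal.ofReal (growthConst ℓ κ) *
      (‖b‖ₑ ^ 2 + ‖σ‖ₑ ^ 2 + ENNReal.ofReal (Real.exp (-ρ)) * ‖f‖ₑ ^ 2 + ‖Λ‖ₑ ^ 2) := by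
  have key : ‖u.1 - v.1‖ ^ 2 + ‖u.2 - v.2‖ ^ 2 ≤ growthConst ℓ κ *
      (‖b‖ ^ 2 + ‖σ‖ ^ 2 + Real.exp (-ρ) * ‖f‖ ^ 2 + ‖Λ‖ ^ 2) := by
    have hr1 := four_mul_sq_mul_exp_lt_one hρ
    have hr2 := six_mul_sq_lt_exp hρ'
    obtain ⟨t, ht, h1, h2, e⟩ := exists_sqrt_exp hρ hρ'
    have hS := norm_sq_shift_add_shift (ρ := ρ) (n := n) hw
    rw [e] at hm hS hu hv₁ hv₂ hr1 hr2
    refine (norm_sq_sub_le_of_eq_rhs ht h1 h2 hκ hS hΦ.isLipschitz_toHilbert hm hu hv₁ hv₂).trans ?_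
    rw [growthConst, mul_assoc (3 * _), e]
    gcongr
    have hL1 := ℓ.L₁_pos
    have hL2 := ℓ.L₂_pos
    have g1 : t ^ 2 ≤ 1 / (4 * ℓ.L₁ ^ 2) := by
      rw [le_div_iff₀ (by positivity)]
      linarith
    have g2 : 1 ≤ 1 / (6 * ℓ.L₂ ^ 2) * t ^ 2 := by
      rw [one_div, ← div_eq_inv_mul, le_div_iff₀ (by positivity)]
      linarith
    have i1 : t ^ 2 * (‖b‖ ^ 2 + ‖σ‖ ^ 2) ≤ 1 / (4 * ℓ.L₁ ^ 2) * (‖b‖ ^ 2 + ‖σ‖ ^ 2) := by gcongr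
    have i2 : 1 * ‖f‖ ^ 2 ≤ 1 / (6 * ℓ.L₂ ^ 2) * t ^ 2 * ‖f‖ ^ 2 := by gcongr
    have p1 : 0 ≤ 1 / (4 * ℓ.L₁ ^ 2) := by positivity
    have p2 : 0 ≤ 1 / (6 * ℓ.L₂ ^ 2) := by positivity
    generalize 1 / (4 * ℓ.L₁ ^ 2) = c₁ at *
    generalize 1 / (6 * ℓ.L₂ ^ 2) = c₂ at *
    have j1 : 0 ≤ c₁ * (t ^ 2 * ‖f‖ ^ 2 + ‖Λ‖ ^ 2) := by positivity
    have j2 : 0 ≤ c₂ * (‖b‖ ^ 2 + ‖σ‖ ^ 2 + ‖Λ‖ ^ 2) := by positivity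
    have j3 : 0 ≤ ‖b‖ ^ 2 + ‖σ‖ ^ 2 + t ^ 2 * ‖f‖ ^ 2 := by positivity
    linarith
  have hsq : ∀ g : StageL2 P ρ ℱ n, ‖g‖ₑ ^ 2 = ENNReal.ofReal (‖g‖ ^ 2) := fun g => by
    rw [ENNReal.ofReal_pow (norm_nonneg _), ofReal_norm]
  simp only [hsq]
  rw [← ENNReal.ofReal_mul (Real.exp_nonneg _), ← ENNReal.ofReal_add (by positivity) (by positivity),
    ← ENNReal.ofReal_add (by positivity) (by positivity),
    ← ENNReal.ofReal_add (by positivity) (by positivity),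
    ← ENNReal.ofReal_add (by positivity) (by positivity),
    ← ENNReal.ofReal_mul (growthConst_pos ℓ hκ).le]
  exact ENNReal.ofReal_le_ofReal key

namespace LipschitzAssumption

theorem sqNorm_sub_le (hw : IsNoise P ℱ w) (hρ : Real.log (4 * ℓ.L₁ ^ 2) < ρ)
    (hρ' : ρ < -Real.log (6 * ℓ.L₂ ^ 2)) (hΦ : LipschitzAssumption P ℱ ρ ℓ Φ) (hκ : 0 < κ)
    (hm : hΦ.toHilbert.ForwardMonotone (Real.exp (-ρ)) κ ∨
      hΦ.toHilbert.BackwardMonotone (Real.exp (-ρ)) κ)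
    {ℓ' : LipschitzConstants} {Φ' : Coefficients Ω n} (hΦ' : LipschitzAssumption P ℱ ρ ℓ' Φ')
    {x y x' y' : ℕ → Ω → Vec n} (h : IsSolution P ℱ w ρ Φ x y)
    (h' : IsSolution P ℱ w ρ Φ' x' y') :
    sqNorm P ρ (fun k ω => x k ω - x' k ω) + sqNorm P ρ (fun k ω => y k ω - y' k ω) ≤
      ENNReal.ofReal (growthConst ℓ κ) * dataDiff P ℱ w ρ Φ Φ' x' y' := by
  have hu := (hΦ.eq_rhs_iff hw h.memL2_x.coeFn_toStageL2 h.memL2_y.coeFn_toStageL2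
    h.memL2_x h.memL2_y).2 h
  have hv := (hΦ'.eq_rhs_iff hw h'.memL2_x.coeFn_toStageL2 h'.memL2_y.coeFn_toStageL2
    h'.memL2_x h'.memL2_y).2 h'
  have hx := h.memL2_x.coeFn_toStageL2
  have hy := h.memL2_y.coeFn_toStageL2
  have hx' := h'.memL2_x.coeFn_toStageL2
  have hy' := h'.memL2_y.coeFn_toStageL2
  generalize h.memL2_x.toStageL2 = X at *
  generalize h.memL2_y.toStageL2 = Y at *
  generalize h'.memL2_x.toStageL2 = X' at *
  generalize h'.memL2_y.toStageL2 = Y' at *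
  have hY := condY_ae_eq hy'
  have hZ := condZ_ae_eq hw hy'
  have hc := hΦ.coeFn_toHilbert hx' hY hZ
  have hc' := hΦ'.coeFn_toHilbert hx' hY hZ
  have hΛ := hΦ.coeFn_toHilbert hx' hy' hZ
  have hΛ' := hΦ'.coeFn_toHilbert hx' hy' hZ
  have hsub : ∀ {U V : StageL2 P ρ ℱ n} {a b : ℕ → Ω → Vec n}, (∀ k, ∀ᵐ ω ∂P, U (k, ω) = a k ω) →
      (∀ k, ∀ᵐ ω ∂P, V (k, ω) = b k ω) → ∀ k, ∀ᵐ ω ∂P, (U - V) (k, ω) = a k ω - b k ω := by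
    intro U V a b ha hb k
    filter_upwards [ae_stageMeasure_iff.1 (lpMeas_coeFn_sub U V) k, ha k, hb k] with ω e1 e2 e3
    rw [e1, e2, e3]
  rw [sqNorm_eq_enorm_sq (hsub hx hx'), sqNorm_eq_enorm_sq (hsub hy hy')]
  set D₁ := scaledAdjoint (Real.exp (-ρ)) (timeShift P ρ ℱ n) Y'
  set D₂ := scaledAdjoint (Real.exp (-ρ)) (hw.noiseShift ρ n) Y'
  refine (enorm_sq_sub_le hw hρ hρ' hΦ hκ hm hu (v := (X', Y'))
    (b := hΦ.toHilbert.b X' D₁ D₂ - hΦ'.toHilbert.b X' D₁ D₂)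
    (σ := hΦ.toHilbert.σ X' D₁ D₂ - hΦ'.toHilbert.σ X' D₁ D₂)
    (Λ := hΦ.toHilbert.Λ Y' - hΦ'.toHilbert.Λ Y')
    (f := hΦ.toHilbert.f X' D₁ D₂ - hΦ'.toHilbert.f X' D₁ D₂) ?_ ?_).trans ?_
  · have e : (X', Y').1 = _ := congrArg Prod.fst hv
    rw [Prod.fst_sub, e]
    simp only [HilbertCoefficients.rhs, map_sub]
    abel
  · have e : (X', Y').2 = _ := congrArg Prod.snd hv
    rw [Prod.snd_sub, e]
    simp only [HilbertCoefficients.rhs]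
    abel
  · gcongr
    refine enorm_sq_add_le (hsub (fun k => (hc k).mono fun ω h => h.1)
      fun k => (hc' k).mono fun ω h => h.1)
      (hsub (fun k => (hc k).mono fun ω h => h.2.1) fun k => (hc' k).mono fun ω h => h.2.1)
      (hsub (fun k => (hc k).mono fun ω h => h.2.2.1) fun k => (hc' k).mono fun ω h => h.2.2.1)
      (l := fun ω => Φ.Λ (y' 0 ω) - Φ'.Λ (y' 0 ω)) fun k => ?_
    filter_upwards [hsub (fun k => (hΛ k).mono fun ω h => h.2.2.2)
      (fun k => (hΛ' k).mono fun ω h => h.2.2.2) k] with ω e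
    rw [e]
    split_ifs
    · rfl
    · rw [sub_zero]

theorem sqNorm_le (hw : IsNoise P ℱ w) (hρ : Real.log (4 * ℓ.L₁ ^ 2) < ρ)
    (hρ' : ρ < -Real.log (6 * ℓ.L₂ ^ 2)) (hΦ : LipschitzAssumption P ℱ ρ ℓ Φ) (hκ : 0 < κ)
    (hm : hΦ.toHilbert.ForwardMonotone (Real.exp (-ρ)) κ ∨
      hΦ.toHilbert.BackwardMonotone (Real.exp (-ρ)) κ)
    {x y : ℕ → Ω → Vec n} (h : IsSolution P ℱ w ρ Φ x y) :
    sqNorm P ρ x + sqNorm P ρ y ≤ ENNReal.ofReal (growthConst ℓ κ) * dataSize P ρ Φ := by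
  have hu := (hΦ.eq_rhs_iff hw h.memL2_x.coeFn_toStageL2 h.memL2_y.coeFn_toStageL2
    h.memL2_x h.memL2_y).2 h
  rw [sqNorm_eq_enorm_sq h.memL2_x.coeFn_toStageL2, sqNorm_eq_enorm_sq h.memL2_y.coeFn_toStageL2]
  have h0 : ∀ k, ∀ᵐ ω ∂P, (0 : StageL2 P ρ ℱ n) (k, ω) = 0 :=
    ae_stageMeasure_iff.1 lpMeas_coeFn_zero
  have hc := hΦ.coeFn_toHilbert h0 h0 h0
  -- The residual at `v = 0` consists of the coefficients at the origin.
  have hle := enorm_sq_sub_le hw hρ hρ' hΦ hκ hm hu (v := 0) (b := hΦ.toHilbert.b 0 0 0)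
    (σ := hΦ.toHilbert.σ 0 0 0) (Λ := hΦ.toHilbert.Λ 0) (f := hΦ.toHilbert.f 0 0 0)
    (by simp [HilbertCoefficients.rhs]) (by simp [HilbertCoefficients.rhs])
  rw [Prod.fst_zero, Prod.snd_zero, sub_zero, sub_zero] at hle
  refine hle.trans ?_
  gcongr
  exact enorm_sq_add_le (fun k => (hc k).mono fun ω h => h.1)
    (fun k => (hc k).mono fun ω h => h.2.1) (fun k => (hc k).mono fun ω h => h.2.2.1)
    (l := fun _ => Φ.Λ 0) fun k => (hc k).mono fun ω h => h.2.2.2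

end LipschitzAssumption

end Solutions

theorem mainTheorem1 (ℓ : LipschitzConstants) (μ ν cM cA cB cC : ℝ) :
    ∃ K : ℝ, 0 < K ∧
      ∀ (n m : ℕ) (Ω : Type*) (mΩ : MeasurableSpace Ω) (P : Measure Ω)
        (_ : IsProbabilityMeasure P) (ℱ : Filtration ℕ mΩ) (w : ℕ → Ω → ℝ) (ρ : ℝ)
        (M : Matrix (Fin m) (Fin n) ℝ) (A B C : ℕ → Ω → Matrix (Fin m) (Fin n) ℝ)
        (Φ : Coefficients Ω n),
        IsNoise P ℱ w →
        Real.log (4 * ℓ.L₁ ^ 2) < ρ → ρ < -Real.log (6 * ℓ.L₂ ^ 2) →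
        frobNorm M ≤ cM → MemLinf P ℱ cA A → MemLinf P ℱ cB B → MemLinf P ℱ cC C →
        LipschitzAssumption P ℱ ρ ℓ Φ →
        DominationMonotonicity P ρ μ ν M A B C Φ →
        -- existence
        (∃ x y : ℕ → Ω → Vec n, IsSolution P ℱ w ρ Φ x y) ∧
        -- uniqueness
        (∀ x y x' y' : ℕ → Ω → Vec n, IsSolution P ℱ w ρ Φ x y → IsSolution P ℱ w ρ Φ x' y' →
          ∀ k, x k =ᵐ[P] x' k ∧ y k =ᵐ[P] y' k) ∧
        -- a priori bound
        (∀ x y : ℕ → Ω → Vec n, IsSolution P ℱ w ρ Φ x y →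
          sqNorm P ρ x + sqNorm P ρ y ≤ ENNReal.ofReal K * dataSize P ρ Φ) ∧
        -- stability estimate
        (∀ (ℓ' : LipschitzConstants) (m' : ℕ) (μ' ν' cA' cB' cC' : ℝ)
          (M' : Matrix (Fin m') (Fin n) ℝ) (A' B' C' : ℕ → Ω → Matrix (Fin m') (Fin n) ℝ)
          (Φ' : Coefficients Ω n),
          MemLinf P ℱ cA' A' → MemLinf P ℱ cB' B' → MemLinf P ℱ cC' C' →
          LipschitzAssumption P ℱ ρ ℓ' Φ' →
          DominationMonotonicity P ρ μ' ν' M' A' B' C' Φ' →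
          ∀ x y x' y' : ℕ → Ω → Vec n,
            IsSolution P ℱ w ρ Φ x y → IsSolution P ℱ w ρ Φ' x' y' →
            sqNorm P ρ (fun k ω => x k ω - x' k ω) + sqNorm P ρ (fun k ω => y k ω - y' k ω) ≤
              ENNReal.ofReal K * dataDiff P ℱ w ρ Φ Φ' x' y') := by
  by_cases hμν : (0 < μ ∧ ν = 0) ∨ (μ = 0 ∧ 0 < ν)
  swap
  -- No coefficients satisfy the monotonicity condition for other values of `μ` and `ν`.
  · exact ⟨1, one_pos, fun n m Ω mΩ P _ ℱ w ρ M A B C Φ _ _ _ _ _ _ _ _ h =>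
      absurd h.cases_μν hμν⟩
  -- One of the summands vanishes, and the other one is the monotonicity constant.
  have hκ : 0 < μ ^ 3 / 2 + ν ^ 3 := by
    rcases hμν with ⟨h, rfl⟩ | ⟨rfl, h⟩ <;> simp [h]
  refine ⟨growthConst ℓ (μ ^ 3 / 2 + ν ^ 3), growthConst_pos ℓ hκ, ?_⟩
  intro n m Ω mΩ P _ ℱ w ρ M A B C Φ hw hρ hρ' _ _ _ _ hΦ hd
  have hm : hΦ.toHilbert.ForwardMonotone (Real.exp (-ρ)) (μ ^ 3 / 2 + ν ^ 3) ∨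
      hΦ.toHilbert.BackwardMonotone (Real.exp (-ρ)) (μ ^ 3 / 2 + ν ^ 3) := by
    rcases hμν with ⟨h1, h2⟩ | ⟨h1, h2⟩
    · left
      have := hΦ.forwardMonotone hd h1 h2
      simpa [h2] using this
    · right
      have := hΦ.backwardMonotone hd h1 h2
      simpa [h1] using this
  refine ⟨exists_isSolution hw hρ hρ' hΦ hκ hm, fun x y x' y' h h' k => ?_,
    fun x y h => hΦ.sqNorm_le hw hρ hρ' hκ hm h,
    fun ℓ' m' μ' ν' cA' cB' cC' M' A' B' C' Φ' _ _ _ hΦ' _ x y x' y' h h' =>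
      hΦ.sqNorm_sub_le hw hρ hρ' hκ hm hΦ' h h'⟩
  have hle := hΦ.sqNorm_sub_le hw hρ hρ' hκ hm hΦ h h'
  have h0 : dataDiff P ℱ w ρ Φ Φ x' y' = 0 := by simp [dataDiff]
  rw [h0, mul_zero, nonpos_iff_eq_zero, add_eq_zero] at hle
  exact ⟨ae_eq_of_sqNorm_sub_eq_zero h.memL2_x h'.memL2_x hle.1 k,
    ae_eq_of_sqNorm_sub_eq_zero h.memL2_y h'.memL2_y hle.2 k⟩
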